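/- Let $m \ge 2$ be even and $n\ge 1$. For a real tensor $\mathcal{T}=(\mathcal{T}_{i_1\dots i_m})$ with $m$ modes of dimension $n$, a vector $x\in\mathbb{R}^n$ and $0\le r\le m$, let $\mathcal{T}x^{m-r}$ be the $r$-mode tensor $(\mathcal{T}x^{m-r})_{i_1\dots i_r}=\sum_{i_{r+1},\dots,i_m=1}^n \mathcal{T}_{i_1\dots i_m}x_{i_{r+1}}\cdots x_{i_m}$. For symmetric $\mathcal{T}$ put $$\beta(\mathcal{T})=(m-1)\max_{\|x\|=1}\rho(\mathcal{T}x^{m-2}),$$ where $\rho$ is the spectral radius of a matrix and $\|\cdot\|$ the Euclidean norm. An eigenvector of $\mathcal{T}$ is a vector $x\in\mathbb{R}^n$ with $\|x\|=1$ and $\mathcal{T}x^{m-1}=\mu x$ for some $\mu\in\mathbb{R}$. Let $\mathcal{A}=\lambda\, a^{\otimes m}+\mathcal{E}$, where $\lambda>0$, $a\in\mathbb{R}^n$ with $\|a\|=1$, $(a^{\otimes m})_{i_1\dots i_m}=a_{i_1}\cdots a_{i_m}$, and $\mathcal{E}$ is a symmetric real tensor with $m$ modes of dimension $n$. Let $\alpha\in\mathbb{R}$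 satisfy $\alpha>\beta(\mathcal{E})$. Then for every starting vector $x_0\in\mathbb{R}^n$ with $\|x_0\|=1$, the shifted symmetric higher order power method (SS-HOPM) $$x_{k+1}=\frac{\mathcal{A}x_k^{m-1}+\alpha x_k}{\|\mathcal{A}x_k^{m-1}+\alpha x_k\|},\qquad k=0,1,2,\dots,$$ is well defined (the denominators do not vanish); the generalized Rayleigh quotient is nondecreasing along it, $\mathcal{A}x_{k}^m\le\mathcal{A}x_{k+1}^m$ for all $k$, with strict inequality whenever $x_k$ is not an eigenvector of $\mathcal{A}$; and the sequence $(x_k)$ converges to an eigenvector of $\mathcal{A}$. -/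

import Mathlib

noncomputable section

namespace SymTensor

/-- Real tensors with `m` modes, all of dimension `n`. -/
abbrev Tensor (m n : ℕ) : Type := (Fin m → Fin n) → ℝ

/-- The entries are invariant under permutation of the indices. -/
def IsSymmetric {m n : ℕ} (A : Tensor m n) : Prop :=
  ∀ (σ : Equiv.Perm (Fin m)) (i : Fin m → Fin n), A (i ∘ σ) = A i

/-- The rank-one tensor `a ⊗ a ⊗ ⋯ ⊗ a` (`m` factors). -/
def rankOne {n : ℕ} (m : ℕ) (a : EuclideanSpace ℝ (Fin n)) : Tensor m n :=
  fun i => ∏ t, a (i t)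

/-- The multi-index `(i₁, …, i_r, j₁, …, j_{m-r})`, for `r ≤ m`. -/
def joinIndex {m n : ℕ} (r : ℕ) (i : Fin r → Fin n) (j : Fin (m - r) → Fin n) :
    Fin m → Fin n :=
  fun t => if h : (t : ℕ) < r then i ⟨t, h⟩ else j ⟨(t : ℕ) - r, by omega⟩

/-- The `r`-mode tensor `A x^{m-r}`, for `r ≤ m`: the last `m - r` modes of `A` are contracted
with the vector `x`. -/
def contract {m n : ℕ} (r : ℕ) (A : Tensor m n) (x : EuclideanSpace ℝ (Fin n)) : Tensor r n :=
  fun i => ∑ j : Fin (m - r) → Fin n, A (joinIndex r i j) * ∏ t, x (j t)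

/-- The scalar `A x^m`; for `‖x‖ = 1` this is the generalized Rayleigh quotient. -/
def rayleigh {m n : ℕ} (A : Tensor m n) (x : EuclideanSpace ℝ (Fin n)) : ℝ :=
  contract 0 A x ![]

/-- The vector `A x^{m-1}`. -/
def contractVec {m n : ℕ} (A : Tensor m n) (x : EuclideanSpace ℝ (Fin n)) :
    EuclideanSpace ℝ (Fin n) :=
  WithLp.toLp 2 fun i => contract 1 A x ![i]

/-- The matrix `A x^{m-2}`. -/
def contractMat {m n : ℕ} (A : Tensor m n) (x : EuclideanSpace ℝ (Fin n)) :
    Matrix (Fin n) (Fin n) ℝ :=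
  Matrix.of fun i j => contract 2 A x ![i, j]

/-- `β(A) = (m - 1) max_{‖x‖ = 1} ρ(A x^{m-2})`, with `ρ` the spectral radius. For symmetric `A`
the matrix `A x^{m-2}` is symmetric, so all its eigenvalues are real. -/
def beta {m n : ℕ} (A : Tensor m n) : ℝ :=
  ((m : ℝ) - 1) *
    sSup ((fun x => (spectralRadius ℝ (contractMat A x)).toReal) ''
      Metric.sphere (0 : EuclideanSpace ℝ (Fin n)) 1)

/-- Normalized real (Z-)eigenvectors: `‖x‖ = 1` and `A x^{m-1} = μ x` for some real `μ`. -/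
def IsEigenvector {m n : ℕ} (A : Tensor m n) (x : EuclideanSpace ℝ (Fin n)) : Prop :=
  ‖x‖ = 1 ∧ ∃ μ : ℝ, contractVec A x = μ • x

/-- The unnormalized update `A x^{m-1} + α x`. -/
def shiftedMap {m n : ℕ} (A : Tensor m n) (α : ℝ) (x : EuclideanSpace ℝ (Fin n)) :
    EuclideanSpace ℝ (Fin n) :=
  contractVec A x + α • x

/-- The iterates of the shifted symmetric higher order power method with shift `α`,
started at `x₀`. -/
def ssHopm {m n : ℕ} (A : Tensor m n) (α : ℝ) (x₀ : EuclideanSpace ℝ (Fin n)) :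
    ℕ → EuclideanSpace ℝ (Fin n)
  | 0 => x₀
  | k + 1 => ‖shiftedMap A α (ssHopm A α x₀ k)‖⁻¹ • shiftedMap A α (ssHopm A α x₀ k)

end SymTensor

end

noncomputable section

namespace SymTensor

open ArchimedeanClass

/-! Write `g x = A x^{m-1} + α x` and `β = beta E`. Since `m` is even, the rank-one part contributes
`λ (a·x)^{m-2} (a·v)^2 ≥ 0` to the quadratic form of `A x^{m-2}`, so `(m-1) A x^{m-2} ≥ -β` on the
whole unit ball. Taylor's formula along the chord between two unit vectors then gives `A y^m ≥ A x^m
+ m ⟨g x, y - x⟩ + m (α - β)/2 ‖y - x‖²` (`rayleigh_add_le`). For `y = g x / ‖g x‖` the inner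
product is nonnegative by Cauchy–Schwarz, so each step gains at least a multiple of its squared
length. The part of `A x^{m-1}` orthogonal to `x` has norm at most `‖g x‖` times the step length
(`norm_tangentialVec_le`). With a Łojasiewicz gradient inequality these two facts make the total
length of the path finite; the limit has zero tangential part, hence is an eigenvector.

The Łojasiewicz inequality on the sphere (`exists_lojasiewicz`) is proved by contradiction. A
sequence of counterexamples at levels `t → 0` is replaced by critical points of a penalty
polynomial. In the hyperreals these form a point whose coordinates are algebraic over `ℝ(t)`,
because the penalty has a dominant pure-power term. On the finite extension of `ℝ(t)` generated by
the coordinates, orders of magnitude are discrete, so there is a uniformizer `p` with `t` of order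
`p^e`, and the coordinates expand in powers of `p`. If the tangential gradient is smaller than every
`t^θ`, `θ < 1`, up to constants, discreteness makes it `O(p^e)`. Differentiating `f` along the
truncated expansion, which is tangent to the sphere to order `e`, then gives a derivative of order
at least `e`, whereas `f` has order exactly `e ≥ 1` and its derivative must have order `e - 1`
(`not_dvd_sum_sq_sub_one`). -/

/-! ### Polynomial calculus along formal curves, and an integrality criterion. -/

theorem pderiv_mul_X {R σ : Type*} [CommRing R] [DecidableEq σ] (p : MvPolynomial σ R) (i j : σ) :
    MvPolynomial.pderiv j (p * MvPolynomial.X i) =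
      MvPolynomial.pderiv j p * MvPolynomial.X i + if j = i then p else 0 := by
  rw [MvPolynomial.pderiv_mul, MvPolynomial.pderiv_X]
  rcases eq_or_ne j i with rfl | h <;> simp [*, Ne.symm]

open Polynomial in
/-- Chain rule for substituting univariate polynomials into a multivariate polynomial. -/
theorem derivative_aeval_mvPolynomial {R σ : Type*} [CommRing R] [Fintype σ]
    (f : MvPolynomial σ R) (q : σ → R[X]) :
    derivative (MvPolynomial.aeval q f) =
      ∑ i, MvPolynomial.aeval q (MvPolynomial.pderiv i f) * derivative (q i) := by
  classical
  induction f using MvPolynomial.induction_on with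
  | C a => simp [Polynomial.algebraMap_eq]
  | add p r hp hr => simp [hp, hr, add_mul, Finset.sum_add_distrib]
  | mul_X p i hp =>
    simp only [map_mul, MvPolynomial.aeval_X, derivative_mul, hp, pderiv_mul_X, map_add,
      add_mul, Finset.sum_add_distrib, Finset.sum_mul, apply_ite (MvPolynomial.aeval q), map_zero,
      ite_mul, zero_mul, Finset.sum_ite_eq', Finset.mem_univ, if_true]
    exact congrArg₂ (· + ·) (Finset.sum_congr rfl fun j _ => by ring) rfl

/-- The derivative of a polynomial function along a line. -/
theorem hasDerivAt_eval_line {σ : Type*} [Fintype σ] (f : MvPolynomial σ ℝ) (x v : σ → ℝ) (s : ℝ) :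
    HasDerivAt (fun s : ℝ => MvPolynomial.eval (fun i => x i + s * v i) f)
      (∑ i, MvPolynomial.eval (fun i => x i + s * v i) (MvPolynomial.pderiv i f) * v i) s := by
  classical
  induction f using MvPolynomial.induction_on with
  | C a => simpa using hasDerivAt_const s a
  | add p r hp hr =>
    simp only [map_add, add_mul, Finset.sum_add_distrib]
    exact hp.add hr
  | mul_X p i hp =>
    have hX : HasDerivAt (fun s : ℝ => x i + s * v i) (v i) s := by
      simpa using ((hasDerivAt_id s).mul_const (v i)).const_add (x i)
    simp only [map_mul, MvPolynomial.eval_X]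
    refine (hp.mul hX).congr_deriv ?_
    simp only [pderiv_mul_X, map_mul, map_add, MvPolynomial.eval_X,
      add_mul, Finset.sum_add_distrib, apply_ite (MvPolynomial.eval _), map_zero,
      ite_mul, zero_mul, Finset.sum_ite_eq', Finset.mem_univ, if_true]
    congr 1
    rw [Finset.sum_mul]
    exact Finset.sum_congr rfl fun j _ => by ring

/-- Polynomials respect congruences; this lets coordinates be exchanged for their truncated
expansions. -/
theorem dvd_aeval_sub_aeval {O σ : Type*} [CommRing O] [Algebra ℝ O] {d : O} {x y : σ → O}
    (h : ∀ i, d ∣ x i - y i) (f : MvPolynomial σ ℝ) :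
    d ∣ MvPolynomial.aeval x f - MvPolynomial.aeval y f := by
  induction f using MvPolynomial.induction_on with
  | C a => simp
  | add p r hp hr =>
    simp only [map_add]
    rw [add_sub_add_comm]
    exact dvd_add hp hr
  | mul_X p i hp =>
    simp only [map_mul, MvPolynomial.aeval_X]
    have : MvPolynomial.aeval x p * x i - MvPolynomial.aeval y p * y i =
      (MvPolynomial.aeval x p - MvPolynomial.aeval y p) * x i
        + MvPolynomial.aeval y p * (x i - y i) := by ring
    rw [this]
    exact dvd_add (hp.mul_right _) ((h i).mul_left _)

open Polynomial in
/-- If the coordinates of a point `x` of the unit sphere have expansions in powers of `π`, and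
`f x` has order exactly `e ≥ 1` in `π`, then the tangential gradient of `f` at `x` has order less
than `e`. -/
theorem not_dvd_sum_sq_sub_one {O σ : Type*} [CommRing O] [Algebra ℝ O] [Fintype σ] {π : O}
    (hπ : ∀ (p : ℝ[X]) (k : ℕ), π ^ k ∣ aeval π p → X ^ k ∣ p)
    (f : MvPolynomial σ ℝ) (x : σ → O) (q : σ → ℝ[X]) {e : ℕ} (he : 1 ≤ e)
    (hq : ∀ i, π ^ (e + 1) ∣ x i - aeval π (q i))
    (hf : π ^ e ∣ MvPolynomial.aeval x f) (hf' : ¬ π ^ (e + 1) ∣ MvPolynomial.aeval x f) (b : O)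
    (hg : ∀ i, π ^ e ∣ MvPolynomial.aeval x (MvPolynomial.pderiv i f) - b * x i) :
    ¬ π ^ (e + 1) ∣ ∑ i, x i ^ 2 - 1 := by
  intro hS
  have hle : π ^ e ∣ π ^ (e + 1) := pow_dvd_pow _ (Nat.le_succ e)
  have key : ∀ h : MvPolynomial σ ℝ,
      π ^ (e + 1) ∣ MvPolynomial.aeval x h - aeval π (MvPolynomial.aeval q h) := by
    intro h
    have := dvd_aeval_sub_aeval hq h
    rwa [show MvPolynomial.aeval (fun i => aeval π (q i)) h
      = aeval π (MvPolynomial.aeval q h) from ?_] at this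
    rw [← AlgHom.comp_apply, MvPolynomial.comp_aeval]
  set p := MvPolynomial.aeval q f with hp
  have hp1 : X ^ e ∣ p := hπ _ _ ((dvd_sub_right hf).1 (hle.trans (key f)))
  have hp2 : ¬ X ^ (e + 1) ∣ p := by
    rintro ⟨r, hr⟩
    have h1 : π ^ (e + 1) ∣ aeval π p := by rw [hr]; simp
    exact hf' ((dvd_sub_left h1).1 (key f))
  -- The truncated curve `q` is tangent to the sphere modulo `π ^ e`: differentiate `∑ q i ^ 2 - 1`,
  -- which is divisible by `X ^ (e + 1)`, and cancel the unit `2`.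
  have hr : π ^ e ∣ ∑ i, x i * aeval π (derivative (q i)) := by
    set S : MvPolynomial σ ℝ := ∑ i, MvPolynomial.X i ^ 2 - 1 with hSdef
    have h1 : X ^ (e + 1) ∣ MvPolynomial.aeval q S := by
      refine hπ _ _ ((dvd_sub_right ?_).1 (key S))
      simpa [hSdef] using hS
    have h2 : X ^ e ∣ derivative (MvPolynomial.aeval q S) := by
      simpa using pow_sub_one_dvd_derivative_of_pow_dvd h1
    have h3 : derivative (MvPolynomial.aeval q S) = C 2 * ∑ i, q i * derivative (q i) := by
      simp [hSdef, Finset.mul_sum, mul_assoc, derivative_pow]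
    rw [h3] at h2
    have h4 : X ^ e ∣ ∑ i, q i * derivative (q i) := by
      have : IsUnit (C (2 : ℝ)) := isUnit_C.2 (isUnit_iff_ne_zero.2 two_ne_zero)
      exact (this.dvd_mul_left).1 h2
    obtain ⟨r, hr⟩ := h4
    have h5 : π ^ e ∣ aeval π (∑ i, q i * derivative (q i)) := by rw [hr]; simp
    refine (dvd_sub_left h5).1 ?_
    rw [map_sum, ← Finset.sum_sub_distrib]
    refine Finset.dvd_sum fun i _ => ?_
    rw [map_mul, ← sub_mul]
    exact (hle.trans (hq i)).mul_right _
  -- By the chain rule and `hg`, modulo `π ^ e` this derivative is `b` times the radial sum in `hr`,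
  -- hence zero.
  have hp3 : X ^ e ∣ derivative p := by
    apply hπ
    rw [hp, derivative_aeval_mvPolynomial, map_sum]
    have : ∑ i, aeval π (MvPolynomial.aeval q (MvPolynomial.pderiv i f) * derivative (q i)) =
        b * ∑ i, x i * aeval π (derivative (q i)) +
        ∑ i, (MvPolynomial.aeval x (MvPolynomial.pderiv i f) - b * x i -
          (MvPolynomial.aeval x (MvPolynomial.pderiv i f) -
            aeval π (MvPolynomial.aeval q (MvPolynomial.pderiv i f)))) *
          aeval π (derivative (q i)) := by
      rw [Finset.mul_sum, ← Finset.sum_add_distrib]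
      refine Finset.sum_congr rfl fun i _ => ?_
      rw [map_mul]; ring
    rw [this]
    refine dvd_add (hr.mul_left _) (Finset.dvd_sum fun i _ => Dvd.dvd.mul_right ?_ _)
    exact dvd_sub (hg i) (hle.trans (key _))
  -- The coefficient of `X ^ d` in the derivative is `(d + 1)` times that of `X ^ (d + 1)` in `p`;
  -- in characteristic zero the latter vanishes too, against `hp2`.
  obtain ⟨d, rfl⟩ : ∃ d, e = d + 1 := ⟨e - 1, by omega⟩
  rw [X_pow_dvd_iff] at hp1 hp2 hp3
  apply hp2
  intro j hj
  rcases Nat.lt_succ_iff_lt_or_eq.1 hj with h | rfl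
  · exact hp1 j h
  · have := hp3 d (Nat.lt_succ_self d)
    rw [coeff_derivative] at this
    have h2 : ((d : ℝ) + 1) ≠ 0 := by positivity
    exact (mul_eq_zero.1 this).resolve_right h2

open Polynomial in
/-- A point whose coordinates satisfy equations `x i ^ D = (polynomial of degree < D)` has
coordinates integral over the base field. -/
theorem isIntegral_of_pow_eq_aeval {k B σ : Type*} [Field k] [CommRing B] [Algebra k B] [Fintype σ]
    {D : ℕ} (x : σ → B) (P : σ → MvPolynomial σ k) (hP : ∀ i, (P i).totalDegree < D)
    (h : ∀ i, x i ^ D = MvPolynomial.aeval x (P i)) (i : σ) : IsIntegral k (x i) := by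
  classical
  set M : Submodule k B :=
    Submodule.span k (Set.range fun β : σ → Fin D => ∏ i, x i ^ (β i : ℕ)) with hM
  -- Induction on total degree: a factor `x i ^ D` is traded for a value of `P i`, which lowers the
  -- degree. Thus finitely many monomials, with all exponents below `D`, span the generated algebra.
  have key : ∀ d : ℕ, ∀ p : MvPolynomial σ k, p.totalDegree < d → MvPolynomial.aeval x p ∈ M := by
    intro d
    induction d with
    | zero => intro p hp; omega
    | succ d ih =>
      intro p hp
      rw [p.as_sum, map_sum]
      refine Submodule.sum_mem _ fun β hβ => ?_
      have hdeg : (β.sum fun _ n => n) ≤ d :=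
        (MvPolynomial.le_totalDegree hβ).trans (Nat.lt_succ_iff.1 hp)
      rw [MvPolynomial.aeval_monomial, ← Algebra.smul_def]
      refine Submodule.smul_mem _ _ ?_
      by_cases hb : ∀ i, β i < D
      · refine Submodule.subset_span ⟨fun i => ⟨β i, hb i⟩, ?_⟩
        rw [Finsupp.prod_fintype _ _ (by simp)]
      · push Not at hb
        obtain ⟨i, hi⟩ := hb
        set γ : σ →₀ ℕ := β - Finsupp.single i D with hγ
        have hβγ : β = γ + Finsupp.single i D := by
          rw [hγ, tsub_add_cancel_of_le (Finsupp.single_le_iff.2 hi)]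
        have hsum : (β.sum fun _ n => n) = (γ.sum fun _ n => n) + D := by
          rw [hβγ, Finsupp.sum_add_index' (by simp) (by simp)]
          simp
        have : (β.prod fun i n => x i ^ n) =
            MvPolynomial.aeval x (MvPolynomial.monomial γ 1 * P i) := by
          rw [hβγ, Finsupp.prod_add_index' (by simp) (by simp [pow_add]), map_mul, ← h i,
            MvPolynomial.aeval_monomial]
          simp
        rw [this]
        apply ih
        refine (MvPolynomial.totalDegree_mul _ _).trans_lt ?_
        have h1 : (MvPolynomial.monomial γ (1 : k)).totalDegree = γ.sum fun _ n => n :=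
          MvPolynomial.totalDegree_monomial γ one_ne_zero
        have h2 := hP i
        omega
  have hM' : Subalgebra.toSubmodule (MvPolynomial.aeval (R := k) x).range = M := by
    apply le_antisymm
    · rintro _ ⟨p, rfl⟩
      exact key _ p (Nat.lt_succ_self _)
    · rw [hM, Submodule.span_le]
      rintro _ ⟨β, rfl⟩
      exact ⟨∏ i, MvPolynomial.X i ^ (β i : ℕ), by simp⟩
  refine IsIntegral.of_mem_of_fg (MvPolynomial.aeval (R := k) x).range ?_ _
    ⟨MvPolynomial.X i, by simp⟩
  rw [hM', hM]
  exact Submodule.fg_span (Set.finite_range _)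

/-! ### Archimedean classes as a valuation (`0 < mk y` means infinitesimal), and its discreteness on
finite extensions of `ℝ(t)`. -/

section Valuation

variable {L : Type*} [Field L] [LinearOrder L] [IsStrictOrderedRing L]

theorem mk_zpow_pos {p : L} (hp : 0 < mk p) {d : ℤ} (hd : 0 < d) : 0 < mk (p ^ d) := by
  lift d to ℕ using hd.le
  rw [zpow_natCast, mk_pow]
  exact nsmul_pos hp (by simpa using hd.ne')

theorem mk_zpow_neg {p : L} (hp0 : p ≠ 0) (hp : 0 < mk p) {d : ℤ} (hd : d < 0) :
    mk (p ^ d) < 0 := by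
  by_contra! h
  have h1 := mk_zpow_pos hp (neg_pos.2 hd)
  have h2 : mk (p ^ d * p ^ (-d)) = 0 := by
    rw [← zpow_add₀ hp0]; simp
  rw [mk_mul] at h2
  exact absurd h2 (h1.trans_le (le_add_of_nonneg_left h)).ne'

theorem mk_zpow_nonneg_iff {p : L} (hp0 : p ≠ 0) (hp : 0 < mk p) {d : ℤ} :
    0 ≤ mk (p ^ d) ↔ 0 ≤ d := by
  constructor
  · intro h
    by_contra! h'
    exact absurd (mk_zpow_neg hp0 hp h') h.not_gt
  · intro h
    rcases h.eq_or_lt with rfl | h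
    · simp
    · exact (mk_zpow_pos hp h).le

theorem mk_zpow_pos_iff {p : L} (hp0 : p ≠ 0) (hp : 0 < mk p) {d : ℤ} :
    0 < mk (p ^ d) ↔ 0 < d := by
  constructor
  · intro h
    by_contra! h'
    rcases h'.eq_or_lt with rfl | h'
    · simp at h
    · exact absurd (mk_zpow_neg hp0 hp h') h.not_gt
  · exact mk_zpow_pos hp

/-- Comparability is phrased as `mk (a / b) = 0`, which forces both elements to be nonzero because
`mk 0 = ⊤`. -/
theorem mk_eq_of_mk_div_eq_zero {a b : L} (h : mk (a / b) = 0) : mk a = mk b := by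
  have hb : b ≠ 0 := by
    rintro rfl
    simp at h
  have : a = a / b * b := by field_simp
  rw [this, mk_mul, h, zero_add]

theorem mk_div_eq_zero {a b : L} (hb : b ≠ 0) (h : mk a = mk b) : mk (a / b) = 0 := by
  rw [div_eq_mul_inv, mk_mul, h, ← mk_mul, mul_inv_cancel₀ hb, mk_one]

theorem mk_eq_zero_of_mk_pow_eq_zero {z : L} {N : ℕ} (hN : N ≠ 0) (h : mk (z ^ N) = 0) :
    mk z = 0 := by
  rw [mk_pow] at h
  rcases lt_trichotomy (mk z) 0 with h1 | h1 | h1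
  · exact absurd h (nsmul_neg h1 hN).ne
  · exact h1
  · exact absurd h (nsmul_pos h1 hN).ne'

theorem mk_div_zpow {y p : L} (hp0 : p ≠ 0) {l : ℤ} (hl : mk (y / p ^ l) = 0) (d : ℤ) :
    mk (y / p ^ d) = mk (p ^ (l - d)) := by
  have : y / p ^ d = y / p ^ l * p ^ (l - d) := by
    rw [zpow_sub₀ hp0]
    have := zpow_ne_zero l hp0
    field_simp
  rw [this, mk_mul, hl, zero_add]

/-- In a vanishing sum which is not identically zero, two of the terms have the same nonzero
order of magnitude. -/
theorem exists_mk_eq_mk_of_sum_eq_zero {ι : Type*} {s : Finset ι} {a : ι → L}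
    (h : ∑ i ∈ s, a i = 0) (hne : ∃ i ∈ s, a i ≠ 0) :
    ∃ i ∈ s, ∃ j ∈ s, i ≠ j ∧ a i ≠ 0 ∧ a j ≠ 0 ∧ mk (a i) = mk (a j) := by
  classical
  obtain ⟨i₀, hi₀, h0⟩ := hne
  obtain ⟨i, hi, hmin⟩ := s.exists_min_image (fun i => mk (a i)) ⟨i₀, hi₀⟩
  have hitop : mk (a i) ≠ ⊤ := ne_top_of_le_ne_top (by simpa using h0) (hmin i₀ hi₀)
  by_contra! hcon
  have hlt : ∀ j ∈ s.erase i, mk (a i) < mk (a j) := by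
    intro j hj
    have hj' := Finset.mem_erase.1 hj
    refine lt_of_le_of_ne (hmin j hj'.2) fun he => ?_
    refine hcon i hi j hj'.2 hj'.1.symm (by simpa using hitop) ?_ he
    rw [he] at hitop
    simpa using hitop
  have hsum : mk (a i) < mk (∑ j ∈ s.erase i, a j) :=
    AddValuation.map_lt_sum (addValuation L) hitop hlt
  rw [← Finset.add_sum_erase s a hi] at h
  have := mk_add_eq_mk_left hsum
  rw [h] at this
  exact hitop (by simpa using this.symm)

/-- If every element of `F` is comparable to a power of `t`, then in a finite extension of `F` a
fixed power of each element is comparable to a power of `t`. -/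
theorem exists_mk_pow_eq_zpow {F : Type*} [Field F] [Algebra F L] {t : L} (ht0 : t ≠ 0)
    (hF : ∀ c : F, c ≠ 0 → ∃ l : ℤ, mk (algebraMap F L c / t ^ l) = 0)
    (K : IntermediateField F L) [FiniteDimensional F K] {y : L} (hy : y ∈ K) (hy0 : y ≠ 0) :
    ∃ l : ℤ, mk (y ^ (Module.finrank F K).factorial / t ^ l) = 0 := by
  set N := Module.finrank F K with hN
  set P := minpoly F (⟨y, hy⟩ : K) with hP
  have hdeg : P.natDegree ≤ N := minpoly.natDegree_le _
  have hint : IsIntegral F (⟨y, hy⟩ : K) := IsIntegral.of_finite _ _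
  have hroot : Polynomial.aeval y P = 0 := by
    have h := minpoly.aeval F (⟨y, hy⟩ : K)
    have h2 := congrArg (algebraMap K L) h
    rwa [map_zero, ← Polynomial.aeval_algebraMap_apply] at h2
  rw [Polynomial.aeval_eq_sum_range] at hroot
  -- Two terms of the minimal polynomial at `y` balance, so `y ^ (j - i)` is comparable to a
  -- quotient of coefficients. As `j - i` is at most the degree, it divides the factorial, which
  -- makes the exponent uniform in `y`.
  obtain ⟨i, hi, j, hj, hij, hi0, hj0, he⟩ := exists_mk_eq_mk_of_sum_eq_zero hroot
    ⟨P.natDegree, by simp, by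
      rw [Polynomial.coeff_natDegree, (minpoly.monic hint).leadingCoeff]
      simp [hy0]⟩
  wlog hlt : i < j generalizing i j
  · exact this j hj i hi hij.symm hj0 hi0 he.symm (lt_of_le_of_ne (not_lt.1 hlt) hij.symm)
  have hci : algebraMap F L (P.coeff i) ≠ 0 := by
    intro h; apply hi0; rw [Algebra.smul_def]; simp [h]
  have hcj : algebraMap F L (P.coeff j) ≠ 0 := by
    intro h; apply hj0; rw [Algebra.smul_def]; simp [h]
  obtain ⟨li, hli⟩ := hF (P.coeff i) (by rintro h; simp [h] at hci)
  obtain ⟨lj, hlj⟩ := hF (P.coeff j) (by rintro h; simp [h] at hcj)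
  have hd : j - i ∣ N.factorial := by
    refine Nat.dvd_factorial (by omega) ?_
    have := Finset.mem_range.1 hj
    omega
  obtain ⟨c, hc⟩ := hd
  refine ⟨(li - lj) * c, ?_⟩
  have hmain : mk (y ^ (j - i) / t ^ (li - lj)) = 0 := by
    rw [Algebra.smul_def, Algebra.smul_def] at he
    have h1 : y ^ (j - i) / t ^ (li - lj) = (algebraMap F L (P.coeff j) * y ^ j) /
        (algebraMap F L (P.coeff i) * y ^ i) * (algebraMap F L (P.coeff i) / t ^ li) /
          (algebraMap F L (P.coeff j) / t ^ lj) := by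
      have h2 : y ^ j = y ^ (j - i) * y ^ i := by rw [← pow_add]; congr 1; omega
      rw [zpow_sub₀ ht0, h2]
      have := zpow_ne_zero li ht0
      have := zpow_ne_zero lj ht0
      field_simp
    rw [h1, mk_div, mk_mul, hli, hlj, mk_div_eq_zero (mul_ne_zero hci (pow_ne_zero _ hy0)) he.symm]
    simp
  have : y ^ N.factorial / t ^ ((li - lj) * (c : ℤ)) = (y ^ (j - i) / t ^ (li - lj)) ^ c := by
    rw [hc, div_pow, ← pow_mul, zpow_mul, zpow_natCast]
  rw [this, mk_pow, hmain, nsmul_zero]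

/-- If every element of `F` is comparable to a power of `t`, then a finite extension of `F` has an
element `p` such that every nonzero element is comparable to a power of `p`. -/
theorem exists_uniformizer {F : Type*} [Field F] [Algebra F L] {t : L} (ht : 0 < mk t)
    (ht0 : t ≠ 0)
    (hF : ∀ c : F, c ≠ 0 → ∃ l : ℤ, mk (algebraMap F L c / t ^ l) = 0)
    (K : IntermediateField F L) [FiniteDimensional F K] (htK : t ∈ K) :
    ∃ p ∈ K, p ≠ 0 ∧ 0 < mk p ∧ ∀ y ∈ K, y ≠ 0 → ∃ l : ℤ, mk (y / p ^ l) = 0 := by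
  classical
  set N := (Module.finrank F K).factorial with hN
  have hN0 : N ≠ 0 := Nat.factorial_ne_zero _
  -- The uniformizer realizes the least positive `j` for which some `y ^ N` is comparable to `t ^
  -- j`. Dividing any other element by a suitable power of it leaves a remainder exponent below `j`,
  -- hence zero by minimality.
  have hex : ∃ j : ℕ, 0 < j ∧ ∃ y ∈ K, y ≠ 0 ∧ mk (y ^ N / t ^ (j : ℤ)) = 0 :=
    ⟨N, Nat.pos_of_ne_zero hN0, t, htK, ht0, mk_div_eq_zero (zpow_ne_zero _ ht0) (by simp)⟩
  obtain ⟨hj0, p, hpK, hp0, hp⟩ := Nat.find_spec hex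
  set j := Nat.find hex with hj
  refine ⟨p, hpK, hp0, ?_, ?_⟩
  · have h1 := mk_eq_of_mk_div_eq_zero hp
    have h2 : 0 < mk (t ^ (j : ℤ)) := mk_zpow_pos ht (by exact_mod_cast hj0)
    by_contra! h3
    rw [← h1, mk_pow] at h2
    exact absurd (nsmul_nonpos h3 N) h2.not_ge
  · intro y hyK hy0
    obtain ⟨l, hl⟩ := exists_mk_pow_eq_zpow ht0 hF K hyK hy0
    have hjz : (0 : ℤ) < j := by exact_mod_cast hj0
    refine ⟨l / j, ?_⟩
    set z := y / p ^ (l / (j : ℤ)) with hz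
    have hz0 : z ≠ 0 := div_ne_zero hy0 (zpow_ne_zero _ hp0)
    have hzK : z ∈ K := K.div_mem hyK (zpow_mem hpK _)
    have hr0 : 0 ≤ l % j := Int.emod_nonneg _ hjz.ne'
    have hrj : l % j < j := Int.emod_lt_of_pos _ hjz
    have hzN : mk (z ^ N / t ^ (l % j)) = 0 := by
      have : z ^ N / t ^ (l % (j : ℤ)) =
          y ^ N / t ^ l / (p ^ N / t ^ (j : ℤ)) ^ (l / (j : ℤ)) := by
        have hpow : t ^ l = t ^ ((j : ℤ) * (l / j)) * t ^ (l % (j : ℤ)) := by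
          rw [← zpow_add₀ ht0, Int.mul_ediv_add_emod]
        rw [hz, hpow, div_pow, div_zpow, ← zpow_mul, ← zpow_natCast (p ^ (l / (j : ℤ))) N,
          ← zpow_natCast p N, ← zpow_mul, ← zpow_mul, mul_comm (l / (j : ℤ)) (N : ℤ)]
        have := zpow_ne_zero ((j : ℤ) * (l / j)) ht0
        have := zpow_ne_zero (l % (j : ℤ)) ht0
        have := zpow_ne_zero ((N : ℤ) * (l / j)) hp0
        field_simp
      rw [this, mk_div, hl, mk_zpow, hp]
      simp
    obtain ⟨r, hr⟩ : ∃ r : ℕ, l % (j : ℤ) = r := ⟨(l % (j : ℤ)).toNat, (Int.toNat_of_nonneg hr0).symm⟩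
    rw [hr] at hzN hrj
    rcases Nat.eq_zero_or_pos r with h | h
    · rw [h] at hzN
      exact mk_eq_zero_of_mk_pow_eq_zero hN0 (by simpa using hzN)
    · exact absurd ⟨h, z, hzK, hz0, hzN⟩ (Nat.find_min hex (by rw [← hj]; exact_mod_cast hrj))

variable [Algebra ℝ L]

variable (L) in
/-- The structure map of an ordered field over `ℝ`, as a homomorphism of ordered rings. -/
def realOrderHom : ℝ →+*o L :=
  { algebraMap ℝ L with
    monotone' := by
      intro a b hab
      have h : algebraMap ℝ L b - algebraMap ℝ L a = algebraMap ℝ L (√(b - a)) ^ 2 := by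
        rw [← map_sub, ← map_pow, Real.sq_sqrt (sub_nonneg.2 hab)]
      exact sub_nonneg.1 (h ▸ sq_nonneg _) }

theorem mk_algebraMap {r : ℝ} (hr : r ≠ 0) : mk (algebraMap ℝ L r) = 0 :=
  mk_map_of_archimedean' (realOrderHom L) hr

theorem mk_algebraMap_nonneg (r : ℝ) : 0 ≤ mk (algebraMap ℝ L r) :=
  mk_map_nonneg_of_archimedean (realOrderHom L) r

variable (L) in
/-- The subalgebra of elements bounded by a real number. -/
def finiteSubalgebra : Subalgebra ℝ L where
  carrier := {y | 0 ≤ mk y}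
  mul_mem' {a b} ha hb := by
    simpa using add_nonneg (Set.mem_ofPred.1 ha) (Set.mem_ofPred.1 hb)
  add_mem' {a b} ha hb := Set.mem_ofPred.2 <|
    (le_min (Set.mem_ofPred.1 ha) (Set.mem_ofPred.1 hb)).trans (min_le_mk_add a b)
  algebraMap_mem' r := Set.mem_ofPred.2 (mk_algebraMap_nonneg r)

theorem mem_finiteSubalgebra {y : L} : y ∈ finiteSubalgebra L ↔ 0 ≤ mk y := Set.mem_ofPred

/-- A polynomial in an infinitesimal is comparable to its lowest order term. -/
theorem mk_aeval_eq {t : L} (ht : 0 < mk t) {p : Polynomial ℝ} (hp : p ≠ 0) :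
    mk (Polynomial.aeval t p) = mk (t ^ p.natTrailingDegree) := by
  set k := p.natTrailingDegree with hk
  have hd : Polynomial.X ^ k ∣ p := by
    rw [Polynomial.X_pow_dvd_iff]
    exact fun d hd => Polynomial.coeff_eq_zero_of_lt_natTrailingDegree hd
  obtain ⟨q, hq⟩ := hd
  have hq0 : q.coeff 0 ≠ 0 := by
    have h1 : p.coeff k ≠ 0 := by
      exact Polynomial.trailingCoeff_nonzero_iff_nonzero.2 hp
    rw [hq, mul_comm] at h1
    simpa [Polynomial.coeff_mul_X_pow'] using h1
  have hfin : ∀ r : Polynomial ℝ, 0 ≤ mk (Polynomial.aeval t r) := fun r =>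
    mem_finiteSubalgebra.1 <| Algebra.adjoin_le (S := finiteSubalgebra L)
      (Set.singleton_subset_iff.2 (mem_finiteSubalgebra.2 ht.le))
      (Polynomial.aeval_mem_adjoin_singleton ℝ t)
  have h0 : mk (Polynomial.aeval t q) = 0 := by
    conv_lhs => rw [← Polynomial.divX_mul_X_add q]
    rw [map_add, add_comm, Polynomial.aeval_C, mk_add_eq_mk_left, mk_algebraMap hq0]
    rw [mk_algebraMap hq0, map_mul, Polynomial.aeval_X, mk_mul]
    exact ht.trans_le (le_add_of_nonneg_left (hfin _))
  conv_lhs => rw [hq]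
  rw [map_mul, mk_mul, h0, add_zero, map_pow, Polynomial.aeval_X]

open IntermediateField in
theorem exists_mk_eq_zpow_of_mem_adjoin {t : L} (ht : 0 < mk t) (ht0 : t ≠ 0) {y : L}
    (hy : y ∈ ℝ⟮t⟯) (hy0 : y ≠ 0) : ∃ l : ℤ, mk (y / t ^ l) = 0 := by
  obtain ⟨r, s, rfl⟩ := (mem_adjoin_simple_iff ℝ y).1 hy
  have hr : r ≠ 0 := by rintro rfl; simp at hy0
  have hs : s ≠ 0 := by rintro rfl; simp at hy0
  refine ⟨(r.natTrailingDegree : ℤ) - s.natTrailingDegree, mk_div_eq_zero (zpow_ne_zero _ ht0) ?_⟩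
  rw [zpow_sub₀ ht0, mk_div, mk_div, mk_aeval_eq ht hr, mk_aeval_eq ht hs, zpow_natCast,
    zpow_natCast]

end Valuation

/-! ### Expansions in a uniformizer, and the lower bound for the tangential gradient at an algebraic
point. -/

section Expansion

variable {L : Type*} [Field L] [LinearOrder L] [IsStrictOrderedRing L] [Algebra ℝ L]

/-- A quotient lies in the ring exactly when it is finite, so estimates of order become divisibility
statements. -/
theorem pow_dvd_iff_mk {p a : finiteSubalgebra L} (hp0 : (p : L) ≠ 0) {k : ℕ} :
    p ^ k ∣ a ↔ 0 ≤ mk ((a : L) / (p : L) ^ k) := by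
  constructor
  · rintro ⟨c, rfl⟩
    have h := mem_finiteSubalgebra.1 c.2
    have : ((p ^ k * c : finiteSubalgebra L) : L) / (p : L) ^ k = c := by
      push_cast
      field_simp
    rwa [this]
  · intro h
    refine ⟨⟨(a : L) / (p : L) ^ k, mem_finiteSubalgebra.2 h⟩, Subtype.ext ?_⟩
    push_cast
    field_simp

theorem X_pow_dvd_of_pow_dvd_aeval {p : finiteSubalgebra L} (hp0 : (p : L) ≠ 0)
    (hp : 0 < mk (p : L)) (q : Polynomial ℝ) (k : ℕ) (h : p ^ k ∣ Polynomial.aeval p q) :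
    Polynomial.X ^ k ∣ q := by
  rcases eq_or_ne q 0 with rfl | hq
  · simp
  rw [pow_dvd_iff_mk hp0] at h
  have h1 : ((Polynomial.aeval p q : finiteSubalgebra L) : L) = Polynomial.aeval (p : L) q :=
    (Polynomial.aeval_algebraMap_apply L p q).symm
  rw [h1, mk_div, mk_aeval_eq hp hq, ← mk_div, ← zpow_natCast, ← zpow_natCast, ← zpow_sub₀ hp0,
    mk_zpow_nonneg_iff hp0 hp] at h
  rw [Polynomial.X_pow_dvd_iff]
  exact fun d hd => Polynomial.coeff_eq_zero_of_lt_natTrailingDegree (by omega)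

variable {F : Type*} [Field F] [Algebra F L]

/-- Finite elements have expansions in powers of a uniformizer with real coefficients. -/
theorem exists_expansion {K : IntermediateField F L} (hK : ∀ r : ℝ, algebraMap ℝ L r ∈ K)
    {p : L} (hpK : p ∈ K) (hp0 : p ≠ 0) (hp : 0 < mk p)
    (hu : ∀ y ∈ K, y ≠ 0 → ∃ l : ℤ, mk (y / p ^ l) = 0)
    {y : L} (hy : y ∈ K) (hfin : 0 ≤ mk y) (k : ℕ) :
    ∃ q : Polynomial ℝ, ∃ z ∈ K, 0 ≤ mk z ∧ y = Polynomial.aeval p q + p ^ k * z := by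
  induction k with
  | zero => exact ⟨0, y, hy, hfin, by simp⟩
  | succ k ih =>
    obtain ⟨q, z, hz, hzfin, h⟩ := ih
    -- Removing the standard part leaves an infinitesimal of `K`, which by discreteness has order at
    -- least one in `p` and so remains finite after division by `p`.
    set c := stdPart z with hc
    have hpos : 0 < mk (z - algebraMap ℝ L c) := mk_sub_stdPart_pos (realOrderHom L) hzfin
    have hzc : z - algebraMap ℝ L c ∈ K := K.sub_mem hz (hK c)
    refine ⟨q + Polynomial.C c * Polynomial.X ^ k, (z - algebraMap ℝ L c) / p,
      K.div_mem hzc hpK, ?_, ?_⟩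
    · rcases eq_or_ne (z - algebraMap ℝ L c) 0 with h0 | h0
      · simp [h0]
      obtain ⟨l, hl⟩ := hu _ hzc h0
      have h1 := mk_div_zpow hp0 hl 0
      have h2 := mk_div_zpow hp0 hl 1
      simp only [zpow_zero, div_one, sub_zero, zpow_one] at h1 h2
      rw [h1, mk_zpow_pos_iff hp0 hp] at hpos
      rw [h2, mk_zpow_nonneg_iff hp0 hp]
      omega
    · rw [h]
      simp only [map_add, map_mul, Polynomial.aeval_C, map_pow, Polynomial.aeval_X]
      field_simp
      ring

open scoped IntermediateField in
open IntermediateField hiding mk in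
/-- Let `x` be a point with finite coordinates algebraic over `ℝ(t)`, `t` a positive infinitesimal,
which lies on the unit sphere and satisfies `f x = t` up to an error negligible compared to `t`.
Then the tangential gradient of `f` at `x` is not of smaller order than all powers `t ^ θ`,
`θ < 1`. -/
theorem not_forall_mk_tangential_le {σ : Type*} [Fintype σ] {t : L} (ht0 : t ≠ 0)
    (ht : 0 < mk t) {x : σ → L} (hint : ∀ i, IsIntegral ℝ⟮t⟯ (x i)) (hfin : ∀ i, 0 ≤ mk (x i))
    (f : MvPolynomial σ ℝ) (hf : mk t < mk (MvPolynomial.aeval x f - t))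
    (hS : mk t < mk ((∑ i, x i ^ 2 - 1 : L))) {b : MvPolynomial σ ℝ} :
    ¬ ∀ i, ∀ N : ℕ, 1 ≤ N → mk (t ^ (2 * N - 1)) ≤
      mk ((MvPolynomial.aeval x (MvPolynomial.pderiv i f) - MvPolynomial.aeval x b * x i)
        ^ (2 * N)) := by
  intro hg
  set K : IntermediateField ℝ⟮t⟯ L := adjoin ℝ⟮t⟯ (Set.range x) with hKdef
  have hfd : FiniteDimensional ℝ⟮t⟯ K :=
    finiteDimensional_adjoin (by rintro _ ⟨i, rfl⟩; exact hint i)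
  have htK : t ∈ K := K.algebraMap_mem ⟨t, mem_adjoin_simple_self ℝ t⟩
  have hRK : ∀ r : ℝ, algebraMap ℝ L r ∈ K := fun r => by
    have := K.algebraMap_mem (algebraMap ℝ ℝ⟮t⟯ r)
    rwa [← IsScalarTower.algebraMap_apply] at this
  have hxK : ∀ i, x i ∈ K := fun i => subset_adjoin _ _ ⟨i, rfl⟩
  have hpolyK : ∀ h : MvPolynomial σ ℝ, MvPolynomial.aeval x h ∈ K := by
    intro h
    induction h using MvPolynomial.induction_on with
    | C a => simpa using hRK a
    | add p r hp hr => simpa using K.add_mem hp hr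
    | mul_X p i hp => simpa using K.mul_mem hp (hxK i)
  obtain ⟨p, hpK, hp0, hp, hu⟩ := exists_uniformizer ht ht0
    (fun c hc => exists_mk_eq_zpow_of_mem_adjoin ht ht0 c.2
      (by simpa using hc)) K htK
  obtain ⟨l, hl⟩ := hu t htK ht0
  have hl0 : 0 < l := by
    have h1 := mk_div_zpow hp0 hl 0
    simp only [zpow_zero, div_one, sub_zero] at h1
    rwa [h1, mk_zpow_pos_iff hp0 hp] at ht
  lift l to ℕ using hl0.le with e
  have he : 1 ≤ e := by omega
  -- elements of `K` which are negligible compared to `t` are divisible by `p ^ (e + 1)`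
  have hgap : ∀ y ∈ K, mk t < mk y → 0 ≤ mk (y / p ^ (e + 1)) := by
    intro y hy hty
    rcases eq_or_ne y 0 with rfl | hy0
    · simp
    obtain ⟨l, hl'⟩ := hu y hy hy0
    rw [mk_eq_of_mk_div_eq_zero hl, mk_eq_of_mk_div_eq_zero hl'] at hty
    have h2 := mk_div_zpow hp0 hl' ((e + 1 : ℕ) : ℤ)
    rw [zpow_natCast] at h2
    rw [h2, mk_zpow_nonneg_iff hp0 hp]
    by_contra! hcon
    have h3 : 0 ≤ mk (p ^ ((e : ℤ) - l)) :=
      (mk_zpow_nonneg_iff hp0 hp).2 (by push_cast at hcon; omega)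
    have h4 : p ^ (e : ℤ) = p ^ l * p ^ ((e : ℤ) - l) := by
      rw [← zpow_add₀ hp0]; congr 1; ring
    rw [h4, mk_mul] at hty
    exact absurd (le_add_of_nonneg_right h3) hty.not_ge
  have hfe : ∀ y ∈ K, mk t < mk (y - t) →
      0 ≤ mk (y / p ^ e) ∧ ¬ 0 ≤ mk (y / p ^ (e + 1)) := by
    intro y hy hty
    have hmk : mk y = mk t := by
      have := mk_add_eq_mk_left hty
      rwa [add_sub_cancel] at this
    have h1 : mk (y / p ^ (e : ℤ)) = 0 := by
      rw [mk_div, hmk, ← mk_div, hl]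
    have h2 := mk_div_zpow hp0 h1 ((e + 1 : ℕ) : ℤ)
    rw [zpow_natCast] at h1 h2
    refine ⟨h1.ge, ?_⟩
    rw [h2, mk_zpow_nonneg_iff hp0 hp]
    push_cast
    omega
  have hge : ∀ y ∈ K, (∀ N : ℕ, 1 ≤ N → mk (t ^ (2 * N - 1)) ≤ mk (y ^ (2 * N))) →
      0 ≤ mk (y / p ^ e) := by
    intro y hy hN
    rcases eq_or_ne y 0 with rfl | hy0
    · simp
    obtain ⟨l, hl'⟩ := hu y hy hy0
    -- The exponent `N = e` suffices: `e (2e - 1) ≤ 2e l` means `l ≥ e - 1/2`, and `l` is an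
    -- integer.
    have h1 := hN e he
    have h2 := mk_div_zpow hp0 hl' (e : ℤ)
    rw [zpow_natCast] at h2
    rw [h2, mk_zpow_nonneg_iff hp0 hp]
    rw [mk_pow, mk_pow, mk_eq_of_mk_div_eq_zero hl, mk_eq_of_mk_div_eq_zero hl', ← mk_pow, ← mk_pow,
      ← zpow_natCast, ← zpow_natCast, ← zpow_mul, ← zpow_mul] at h1
    by_contra! hcon
    have h3 : 0 < mk (p ^ ((e : ℤ) * ((2 * e - 1 : ℕ) : ℤ) - l * ((2 * e : ℕ) : ℤ))) := by
      refine (mk_zpow_pos_iff hp0 hp).2 ?_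
      push_cast [show 1 ≤ 2 * e by omega]
      nlinarith
    have hne := zpow_ne_zero (l * ((2 * e : ℕ) : ℤ)) hp0
    rw [zpow_sub₀ hp0] at h3
    have h4 : mk (p ^ (l * ((2 * e : ℕ) : ℤ))) < mk (p ^ ((e : ℤ) * ((2 * e - 1 : ℕ) : ℤ))) := by
      refine lt_of_le_of_ne ?_ ?_
      · have : p ^ ((e : ℤ) * ((2 * e - 1 : ℕ) : ℤ)) = p ^ (l * ((2 * e : ℕ) : ℤ)) *
          (p ^ ((e : ℤ) * ((2 * e - 1 : ℕ) : ℤ)) / p ^ (l * ((2 * e : ℕ) : ℤ))) := by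
          field_simp
        rw [this, mk_mul]
        exact le_add_of_nonneg_right h3.le
      · intro h
        rw [mk_div_eq_zero hne h.symm] at h3
        exact lt_irrefl _ h3
    exact absurd h1 h4.not_ge
  -- descend to the ring of finite elements
  let π : finiteSubalgebra L := ⟨p, mem_finiteSubalgebra.2 hp.le⟩
  let ξ : σ → finiteSubalgebra L := fun i => ⟨x i, mem_finiteSubalgebra.2 (hfin i)⟩
  have hcoe : ∀ h : MvPolynomial σ ℝ, ((MvPolynomial.aeval ξ h : finiteSubalgebra L) : L) =
      MvPolynomial.aeval x h := fun h =>
    (MvPolynomial.aeval_algebraMap_apply (B := L) ξ h).symm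
  choose q z hzK hz hqz using fun i => exists_expansion hRK hpK hp0 hp hu (hxK i) (hfin i) (e + 1)
  refine not_dvd_sum_sq_sub_one (π := π) (X_pow_dvd_of_pow_dvd_aeval hp0 hp) f ξ q he ?_ ?_ ?_
    (MvPolynomial.aeval ξ b) ?_ ?_
  · intro i
    refine ⟨⟨z i, mem_finiteSubalgebra.2 (hz i)⟩, Subtype.ext ?_⟩
    push_cast
    exact sub_eq_of_eq_add' (hqz i)
  · rw [pow_dvd_iff_mk hp0, hcoe]
    exact (hfe _ (hpolyK f) hf).1
  · rw [pow_dvd_iff_mk hp0, hcoe]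
    exact (hfe _ (hpolyK f) hf).2
  · intro i
    rw [pow_dvd_iff_mk hp0]
    push_cast
    rw [hcoe, hcoe]
    exact hge _ (K.sub_mem (hpolyK _) (K.mul_mem (hpolyK b) (hxK i))) (hg i)
  · rw [pow_dvd_iff_mk hp0]
    push_cast
    exact hgap _ (K.sub_mem (K.sum_mem fun i _ => pow_mem (hxK i) 2) K.one_mem) hS

end Expansion

/-! ### The Łojasiewicz gradient inequality on the sphere. -/

section Lojasiewicz

variable {σ : Type*} [Fintype σ]

/-- The components of the gradient of `f`, made tangential to the unit sphere. -/
def tangentialGrad (f : MvPolynomial σ ℝ) (i : σ) : MvPolynomial σ ℝ :=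
  MvPolynomial.pderiv i f -
    (∑ j, MvPolynomial.X j * MvPolynomial.pderiv j f) * MvPolynomial.X i

/-- The squared norm of the tangential gradient. -/
def tangentialNormSq (f : MvPolynomial σ ℝ) : MvPolynomial σ ℝ :=
  ∑ i, tangentialGrad f i ^ 2

theorem eval_tangentialNormSq (f : MvPolynomial σ ℝ) (x : σ → ℝ) :
    MvPolynomial.eval x (tangentialNormSq f) =
      ∑ i, (MvPolynomial.eval x (tangentialGrad f i)) ^ 2 := by
  simp [tangentialNormSq]

variable (σ) in
/-- The defining equation of the unit sphere. -/
def spherePoly : MvPolynomial σ ℝ := ∑ i, MvPolynomial.X i ^ 2 - 1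

theorem eval_spherePoly (x : σ → ℝ) :
    MvPolynomial.eval x (spherePoly σ) = ∑ i, x i ^ 2 - 1 := by
  simp [spherePoly]

/-- The function minimized in order to select, among the points of the sphere where `f = t` and
the tangential gradient is small, one which is algebraic over `ℝ(t)`. -/
def penalty (f : MvPolynomial σ ℝ) (M : ℕ) (t : ℝ) : MvPolynomial σ ℝ :=
  spherePoly σ ^ 2 + (f - MvPolynomial.C t) ^ 2 + MvPolynomial.C (t ^ 4) * tangentialNormSq f +
    MvPolynomial.C (t ^ 8) * ∑ i, MvPolynomial.X i ^ (2 * M)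

theorem eval_penalty (f : MvPolynomial σ ℝ) (M : ℕ) (t : ℝ) (x : σ → ℝ) :
    MvPolynomial.eval x (penalty f M t) = (∑ i, x i ^ 2 - 1) ^ 2 + (MvPolynomial.eval x f - t) ^ 2 +
      t ^ 4 * MvPolynomial.eval x (tangentialNormSq f) + t ^ 8 * ∑ i, x i ^ (2 * M) := by
  simp [penalty, eval_spherePoly]

theorem pderiv_spherePoly (i : σ) :
    MvPolynomial.pderiv i (spherePoly σ) = 2 * MvPolynomial.X i := by
  classical
  simp only [spherePoly, map_sub, map_sum, MvPolynomial.pderiv_pow, MvPolynomial.pderiv_X]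
  rw [Finset.sum_eq_single i]
  · simp
  · intro j _ hj
    simp [hj]
  · simp

theorem eval_pderiv_penalty (f : MvPolynomial σ ℝ) (M : ℕ) (t : ℝ) (x : σ → ℝ) (i : σ) :
    MvPolynomial.eval x (MvPolynomial.pderiv i (penalty f M t)) =
      MvPolynomial.eval x (4 * spherePoly σ * MvPolynomial.X i +
          2 * f * MvPolynomial.pderiv i f) -
        2 * t * MvPolynomial.eval x (MvPolynomial.pderiv i f) +
        t ^ 4 * MvPolynomial.eval x (MvPolynomial.pderiv i (tangentialNormSq f)) +
        t ^ 8 * (2 * M * x i ^ (2 * M - 1)) := by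
  classical
  have h1 : MvPolynomial.pderiv i (∑ j, MvPolynomial.X j ^ (2 * M) : MvPolynomial σ ℝ) =
      ((2 * M : ℕ) : MvPolynomial σ ℝ) * MvPolynomial.X i ^ (2 * M - 1) := by
    rw [map_sum, Finset.sum_eq_single i]
    · simp
    · intro j _ hj
      simp [MvPolynomial.pderiv_X, hj]
    · simp
  simp only [penalty, map_add, MvPolynomial.pderiv_mul, h1, MvPolynomial.pderiv_pow,
    pderiv_spherePoly, MvPolynomial.pderiv_C, map_sub, map_mul, map_pow, MvPolynomial.eval_C,
    MvPolynomial.eval_X, map_natCast, map_ofNat]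
  push_cast
  simp
  ring

/-- The point is a minimizer over the ball of squared radius `2`. Outside that ball the sphere term
alone exceeds `1`, while the value at `y` is below `1`, so the minimum is global and the gradient
vanishes. -/
theorem exists_critical_point (f : MvPolynomial σ ℝ) {M : ℕ} (hM : 1 ≤ M) {y : σ → ℝ}
    (hy : ∑ i, y i ^ 2 = 1) (ht0 : 0 < MvPolynomial.eval y f)
    (ht1 : MvPolynomial.eval y f ≤ 1 / 2)
    (hG : MvPolynomial.eval y (tangentialNormSq f) ≤ 1) :
    ∃ x : σ → ℝ, ∑ i, x i ^ 2 ≤ 2 ∧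
      MvPolynomial.eval x (penalty f M (MvPolynomial.eval y f)) ≤
        MvPolynomial.eval y f ^ 4 * MvPolynomial.eval y (tangentialNormSq f) +
          MvPolynomial.eval y f ^ 8 ∧
      ∀ i, MvPolynomial.eval x
        (MvPolynomial.pderiv i (penalty f M (MvPolynomial.eval y f))) = 0 := by
  classical
  set t := MvPolynomial.eval y f with ht
  set Φ : (σ → ℝ) → ℝ := fun x => MvPolynomial.eval x (penalty f M t) with hΦ
  have hcont : Continuous Φ := MvPolynomial.continuous_eval _
  have hcpt : IsCompact {x : σ → ℝ | ∑ i, x i ^ 2 ≤ 2} := by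
    refine IsCompact.of_isClosed_subset (isCompact_Icc (a := fun _ : σ => (-2 : ℝ)) (b := fun _ => 2))
      (isClosed_le (by fun_prop) continuous_const) ?_
    intro x hx
    have h1 : ∀ i, x i ^ 2 ≤ 2 := fun i =>
      (Finset.single_le_sum (f := fun i => x i ^ 2) (fun j _ => sq_nonneg _)
        (Finset.mem_univ i)).trans hx
    exact ⟨fun i => by nlinarith [h1 i], fun i => by nlinarith [h1 i]⟩
  have hy2 : y ∈ {x : σ → ℝ | ∑ i, x i ^ 2 ≤ 2} := by
    show ∑ i, y i ^ 2 ≤ 2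
    linarith
  obtain ⟨x, hx, hmin⟩ := hcpt.exists_isMinOn ⟨y, hy2⟩ hcont.continuousOn
  have hΦy : Φ y ≤ t ^ 4 * MvPolynomial.eval y (tangentialNormSq f) + t ^ 8 := by
    rw [hΦ]
    simp only [eval_penalty]
    have h1 : ∀ i, y i ^ (2 * M) ≤ y i ^ 2 := by
      intro i
      have hi : y i ^ 2 ≤ 1 := hy ▸
        (Finset.single_le_sum (f := fun i => y i ^ 2) (fun j _ => sq_nonneg _)
          (Finset.mem_univ i))
      rw [pow_mul]
      exact pow_le_of_le_one (sq_nonneg _) hi (by omega)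
    have h2 : ∑ i, y i ^ (2 * M) ≤ 1 := hy ▸ Finset.sum_le_sum fun i _ => h1 i
    rw [hy, ← ht]
    have h3 : 0 ≤ t ^ 8 := by positivity
    nlinarith
  have ht4 : t ^ 4 ≤ 1 / 16 := by
    calc t ^ 4 ≤ (1 / 2) ^ 4 := pow_le_pow_left₀ ht0.le ht1 4
      _ = 1 / 16 := by norm_num
  have hΦy1 : Φ y < 1 := by
    have h8 : t ^ 8 = t ^ 4 * t ^ 4 := by ring
    have h4 : 0 < t ^ 4 := by positivity
    nlinarith
  have hglob : ∀ z, Φ x ≤ Φ z := by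
    intro z
    by_cases hz : ∑ i, z i ^ 2 ≤ 2
    · exact hmin hz
    · push Not at hz
      refine (hmin hy2).trans (hΦy1.le.trans ?_)
      rw [hΦ]
      simp only [eval_penalty, eval_tangentialNormSq]
      have h1 : 0 ≤ t ^ 4 * ∑ i, (MvPolynomial.eval z (tangentialGrad f i)) ^ 2 :=
        mul_nonneg (by positivity) (Finset.sum_nonneg fun i _ => sq_nonneg _)
      have h2 : 0 ≤ t ^ 8 * ∑ i, z i ^ (2 * M) :=
        mul_nonneg (by positivity) (Finset.sum_nonneg fun i _ => (even_two_mul M).pow_nonneg _)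
      nlinarith [sq_nonneg (MvPolynomial.eval z f - t)]
  refine ⟨x, hx, (hmin hy2).trans hΦy, fun i => ?_⟩
  have hd := hasDerivAt_eval_line (penalty f M t) x (Pi.single i 1) 0
  have hloc : IsLocalMin (fun s : ℝ =>
      MvPolynomial.eval (fun j => x j + s * (Pi.single i (1 : ℝ) : σ → ℝ) j) (penalty f M t)) 0 :=
    Filter.Eventually.of_forall fun s => by simpa using hglob _
  have := hloc.hasDerivAt_eq_zero hd
  simpa [Pi.single_apply] using this

/-- The hyperreal numbers as an algebra over `ℝ`. -/
instance hyperrealAlgebra : Algebra ℝ Hyperreal := Hyperreal.coeRingHom.toRingHom.toAlgebra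

theorem aeval_ofSeq {σ : Type*} (ξ : ℕ → σ → ℝ) (h : MvPolynomial σ ℝ) :
    MvPolynomial.aeval (fun i => Hyperreal.ofSeq fun k => ξ k i) h =
      Hyperreal.ofSeq fun k => MvPolynomial.eval (ξ k) h := by
  induction h using MvPolynomial.induction_on with
  | C a => simp; rfl
  | add p r hp hr => simp only [map_add, hp, hr]; rfl
  | mul_X p i hp => simp only [map_mul, hp, MvPolynomial.aeval_X, MvPolynomial.eval_X]; rfl

theorem mk_le_mk_of_abs_le_mul {L : Type*} [Field L] [LinearOrder L] [IsStrictOrderedRing L]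
    {a b : L} (c : ℕ) (h : |a| ≤ c * |b|) : mk b ≤ mk a :=
  mk_le_mk.2 ⟨c, by rwa [nsmul_eq_mul]⟩

/-- Eventual bounds suffice because the hyperfilter is finer than `atTop`. -/
theorem mk_ofSeq_le_mk_ofSeq {a b : ℕ → ℝ} (c : ℕ)
    (h : ∀ᶠ k in Filter.atTop, |a k| ≤ c * |b k|) :
    mk (Hyperreal.ofSeq b) ≤ mk (Hyperreal.ofSeq a) := by
  refine mk_le_mk_of_abs_le_mul c ?_
  have h1 : |Hyperreal.ofSeq a| = Hyperreal.ofSeq fun k => |a k| := rfl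
  have h2 : (c : Hyperreal) * |Hyperreal.ofSeq b| = Hyperreal.ofSeq fun k => c * |b k| := rfl
  rw [h1, h2, Hyperreal.ofSeq_le_ofSeq]
  exact Nat.hyperfilter_le_atTop h

theorem totalDegree_map_le {τ R S : Type*} [CommRing R] [CommRing S] (φ : R →+* S)
    (p : MvPolynomial τ R) : (MvPolynomial.map φ p).totalDegree ≤ p.totalDegree := by
  rw [MvPolynomial.totalDegree, MvPolynomial.totalDegree]
  exact Finset.sup_mono (MvPolynomial.support_map_subset φ p)

open scoped IntermediateField in
open IntermediateField hiding mk in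
/-- Critical points of the penalty function are algebraic over `ℝ(t)`. -/
theorem isIntegral_of_critical {L : Type*} [Field L] [Algebra ℝ L] (f : MvPolynomial σ ℝ) {M : ℕ}
    (hM : 1 ≤ M)
    (hdeg : ∀ i, (4 * spherePoly σ * MvPolynomial.X i +
        2 * f * MvPolynomial.pderiv i f).totalDegree < 2 * M - 1 ∧
      (MvPolynomial.pderiv i f).totalDegree < 2 * M - 1 ∧
      (MvPolynomial.pderiv i (tangentialNormSq f)).totalDegree < 2 * M - 1)
    {t : L} (ht : t ≠ 0) {x : σ → L}
    (h : ∀ i, MvPolynomial.aeval x (4 * spherePoly σ * MvPolynomial.X i +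
          2 * f * MvPolynomial.pderiv i f) -
        2 * t * MvPolynomial.aeval x (MvPolynomial.pderiv i f) +
        t ^ 4 * MvPolynomial.aeval x (MvPolynomial.pderiv i (tangentialNormSq f)) +
        t ^ 8 * (2 * M * x i ^ (2 * M - 1)) = 0) (i : σ) : IsIntegral ℝ⟮t⟯ (x i) := by
  have : CharZero L := charZero_of_injective_algebraMap (algebraMap ℝ L).injective
  set τ : ℝ⟮t⟯ := ⟨t, mem_adjoin_simple_self ℝ t⟩ with hτ
  -- Solving the critical equation for the pure power `x i ^ (2 * M - 1)` requires division by its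
  -- coefficient `2 M t ^ 8`.
  set κ : ℝ⟮t⟯ := -(τ ^ 8 * (2 * M))⁻¹ with hκ
  have hmap : ∀ p : MvPolynomial σ ℝ,
      (MvPolynomial.map (algebraMap ℝ ℝ⟮t⟯) p).totalDegree ≤ p.totalDegree := fun p =>
    totalDegree_map_le _ _
  refine isIntegral_of_pow_eq_aeval (D := 2 * M - 1) x (fun i => MvPolynomial.C κ *
    (MvPolynomial.map (algebraMap ℝ ℝ⟮t⟯) (4 * spherePoly σ * MvPolynomial.X i +
          2 * f * MvPolynomial.pderiv i f) -
      MvPolynomial.C (2 * τ) * MvPolynomial.map (algebraMap ℝ ℝ⟮t⟯) (MvPolynomial.pderiv i f) +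
      MvPolynomial.C (τ ^ 4) *
        MvPolynomial.map (algebraMap ℝ ℝ⟮t⟯) (MvPolynomial.pderiv i (tangentialNormSq f)))) ?_ ?_ i
  · intro i
    obtain ⟨h1, h2, h3⟩ := hdeg i
    have hC : ∀ (c : ℝ⟮t⟯) (p : MvPolynomial σ ℝ⟮t⟯),
        (MvPolynomial.C c * p).totalDegree ≤ p.totalDegree := fun c p => by
      simpa using MvPolynomial.totalDegree_mul (MvPolynomial.C c) p
    refine (hC _ _).trans_lt ((MvPolynomial.totalDegree_add _ _).trans_lt (max_lt ?_ ?_))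
    · refine (MvPolynomial.totalDegree_sub _ _).trans_lt (max_lt ((hmap _).trans_lt h1) ?_)
      exact (hC _ _).trans_lt ((hmap _).trans_lt h2)
    · exact (hC _ _).trans_lt ((hmap _).trans_lt h3)
  · intro i
    have hi := h i
    have hτL : algebraMap ℝ⟮t⟯ L τ = t := rfl
    rw [map_mul, map_add, map_sub, map_mul (MvPolynomial.aeval x), map_mul (MvPolynomial.aeval x),
      MvPolynomial.aeval_C, MvPolynomial.aeval_C,
      MvPolynomial.aeval_C, MvPolynomial.aeval_map_algebraMap, MvPolynomial.aeval_map_algebraMap,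
      MvPolynomial.aeval_map_algebraMap, hκ]
    simp only [map_neg, map_inv₀, map_mul, map_pow, hτL, map_ofNat, map_natCast] at hi ⊢
    have hM0 : (M : L) ≠ 0 := by exact_mod_cast (by omega : M ≠ 0)
    field_simp
    linear_combination hi

/-- Łojasiewicz gradient inequality for polynomials on the unit sphere. -/
theorem exists_lojasiewicz (f : MvPolynomial σ ℝ) :
    ∃ N : ℕ, 1 ≤ N ∧ ∃ ε : ℝ, 0 < ε ∧ ∀ y : σ → ℝ, ∑ i, y i ^ 2 = 1 →
      0 < MvPolynomial.eval y f → MvPolynomial.eval y f < ε →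
      MvPolynomial.eval y f ^ (2 * N - 1) ≤ MvPolynomial.eval y (tangentialNormSq f) ^ N := by
  classical
  by_contra! hcon
  have hGnn : ∀ x : σ → ℝ, 0 ≤ MvPolynomial.eval x (tangentialNormSq f) := fun x => by
    rw [eval_tangentialNormSq]
    exact Finset.sum_nonneg fun i _ => sq_nonneg _
  -- Letting the exponent grow with `k` defeats every fixed `N`; the levels tend to zero and stay at
  -- most `1 / 2`.
  choose y hy ht0 htε hG using fun k : ℕ =>
    hcon (k + 1) (by omega) (1 / ((k : ℝ) + 2)) (by positivity)
  set t : ℕ → ℝ := fun k => MvPolynomial.eval (y k) f with ht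
  have ht1 : ∀ k, t k ≤ 1 / 2 := fun k => (htε k).le.trans
    (one_div_le_one_div_of_le two_pos (by linarith [Nat.cast_nonneg (α := ℝ) k]))
  -- the tangential gradient at `y k` is eventually small compared to `t k ^ (1 - 1 / (2 * N))`
  have hsmall : ∀ N k : ℕ, N ≤ k + 1 →
      MvPolynomial.eval (y k) (tangentialNormSq f) ^ N ≤ t k ^ (2 * N - 1) := by
    intro N k hNk
    have h1 := pow_le_pow_left₀ (pow_nonneg (hGnn (y k)) _) (hG k).le N
    -- After raising to the power `k + 1`, the comparison of exponents `(2N - 1)(k + 1) ≤ (2k + 1)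
    -- N` is just `N ≤ k + 1`.
    refine le_of_pow_le_pow_left₀ (n := k + 1) (by omega) (pow_nonneg (ht0 k).le _) ?_
    rw [← pow_mul, ← pow_mul] at h1 ⊢
    rw [mul_comm N]
    refine h1.trans (pow_le_pow_of_le_one (ht0 k).le ((ht1 k).trans (by norm_num)) ?_)
    rcases Nat.eq_zero_or_pos N with rfl | hN
    · simp
    obtain ⟨N, rfl⟩ : ∃ a, N = a + 1 := ⟨N - 1, by omega⟩
    rw [show 2 * (N + 1) - 1 = 2 * N + 1 by omega, show 2 * (k + 1) - 1 = 2 * k + 1 by omega]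
    nlinarith
  have hG1 : ∀ k, MvPolynomial.eval (y k) (tangentialNormSq f) ≤ 1 := by
    intro k
    have := hsmall 1 k (by omega)
    norm_num at this
    exact this.trans ((ht1 k).trans (by norm_num))
  -- Chosen so that `2 M - 1` exceeds the degree of every other term in the critical equations.
  set M : ℕ := 1 + ∑ i, ((4 * spherePoly σ * MvPolynomial.X i +
        2 * f * MvPolynomial.pderiv i f).totalDegree + (MvPolynomial.pderiv i f).totalDegree +
      (MvPolynomial.pderiv i (tangentialNormSq f)).totalDegree) with hM
  have hM1 : 1 ≤ M := by omega
  choose x hx2 hxΦ hcrit using fun k => exists_critical_point f hM1 (hy k) (ht0 k) (ht1 k) (hG1 k)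
  have hbound : ∀ k, (∑ i, x k i ^ 2 - 1) ^ 2 + (MvPolynomial.eval (x k) f - t k) ^ 2 +
      t k ^ 4 * MvPolynomial.eval (x k) (tangentialNormSq f) ≤
        t k ^ 4 * MvPolynomial.eval (y k) (tangentialNormSq f) + t k ^ 8 := by
    intro k
    have h := hxΦ k
    rw [eval_penalty] at h
    have h2 : 0 ≤ MvPolynomial.eval (y k) f ^ 8 * ∑ i, x k i ^ (2 * M) :=
      mul_nonneg (by positivity) (Finset.sum_nonneg fun i _ => (even_two_mul M).pow_nonneg _)
    linarith
  have ht4 : ∀ k, 0 < t k ^ 4 := fun k => pow_pos (ht0 k) 4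
  have ht8 : ∀ k, t k ^ 8 = t k ^ 4 * t k ^ 4 := fun k => by ring
  have ht41 : ∀ k, t k ^ 4 ≤ 1 := fun k => pow_le_one₀ (ht0 k).le ((ht1 k).trans (by norm_num))
  -- The weights `t ^ 4` and `t ^ 8` leave an error `t ^ 4` here, harmless since `(t ^ 4) ^ N ≤ t ^
  -- (2 * N - 1)`.
  have hGx : ∀ k, MvPolynomial.eval (x k) (tangentialNormSq f) ≤
      MvPolynomial.eval (y k) (tangentialNormSq f) + t k ^ 4 := by
    intro k
    refine le_of_mul_le_mul_left ?_ (ht4 k)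
    nlinarith [hbound k, ht8 k, sq_nonneg (∑ i, x k i ^ 2 - 1),
      sq_nonneg (MvPolynomial.eval (x k) f - t k)]
  -- The same weights make the errors in the sphere and level equations `O(t ^ 2)`, negligible
  -- compared to `t`.
  have hsq : ∀ k a, a ^ 2 ≤ t k ^ 4 * MvPolynomial.eval (y k) (tangentialNormSq f) + t k ^ 8 →
      |a| ≤ (2 : ℕ) * |t k ^ 2| := by
    intro k a ha
    rw [abs_of_nonneg (sq_nonneg (t k))]
    refine abs_le_of_sq_le_sq ?_ (by positivity)
    have : t k ^ 4 * MvPolynomial.eval (y k) (tangentialNormSq f) ≤ t k ^ 4 :=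
      mul_le_of_le_one_right (ht4 k).le (hG1 k)
    have h8 : t k ^ 8 ≤ t k ^ 4 := by
      rw [ht8 k]
      exact mul_le_of_le_one_right (ht4 k).le (ht41 k)
    push_cast
    nlinarith [ht4 k]
  -- pass to the hyperreal numbers
  set T : Hyperreal := Hyperreal.ofSeq t with hT
  set X : σ → Hyperreal := fun i => Hyperreal.ofSeq fun k => x k i with hX
  have hTpos : 0 < T := by
    have : (0 : Hyperreal) = Hyperreal.ofSeq fun _ => 0 := rfl
    rw [this, hT, Hyperreal.ofSeq_lt_ofSeq]
    exact Filter.Eventually.of_forall ht0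
  have hTmk : 0 < mk T := by
    refine Hyperreal.archimedeanClassMk_pos_of_tendsto ?_
    rw [hT, Hyperreal.tendsto_ofSeq]
    refine Filter.Tendsto.mono_left ?_ Nat.hyperfilter_le_atTop
    refine squeeze_zero (fun k => (ht0 k).le) (fun k => (htε k).le) ?_
    have := (tendsto_one_div_add_atTop_nhds_zero_nat (𝕜 := ℝ)).comp (Filter.tendsto_add_atTop_nat 1)
    refine this.congr fun k => ?_
    simp only [Function.comp_apply]
    push_cast
    ring
  have hT2 : mk T < mk (T ^ 2) := by
    have h1 : mk (T ^ 2) = mk T + mk T := by rw [pow_two, mk_mul]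
    refine lt_of_le_of_ne (h1 ▸ le_add_of_nonneg_left hTmk.le) fun h => ?_
    have h2 := mk_div_eq_zero hTpos.ne' h.symm
    rw [pow_two, mul_div_cancel_right₀ _ hTpos.ne'] at h2
    exact hTmk.ne' h2
  have hT2' : T ^ 2 = Hyperreal.ofSeq fun k => t k ^ 2 := rfl
  refine not_forall_mk_tangential_le hTpos.ne' hTmk (x := X) (f := f)
    (b := ∑ j, MvPolynomial.X j * MvPolynomial.pderiv j f) ?_ ?_ ?_ ?_ ?_
  · refine isIntegral_of_critical f hM1 ?_ hTpos.ne' ?_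
    · intro i
      have := Finset.single_le_sum (f := fun i => (4 * spherePoly σ * MvPolynomial.X i +
        2 * f * MvPolynomial.pderiv i f).totalDegree + (MvPolynomial.pderiv i f).totalDegree +
        (MvPolynomial.pderiv i (tangentialNormSq f)).totalDegree) (fun j _ => Nat.zero_le _)
        (Finset.mem_univ i)
      refine ⟨?_, ?_, ?_⟩ <;> omega
    · intro i
      rw [aeval_ofSeq, aeval_ofSeq, aeval_ofSeq]
      have h1 : (Hyperreal.ofSeq fun k => MvPolynomial.eval (x k)
          (MvPolynomial.pderiv i (penalty f M (t k)))) = 0 := by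
        simp only [ht, hcrit]
        rfl
      simp only [eval_pderiv_penalty] at h1
      exact h1
  · intro i
    have h2 : mk (Hyperreal.ofSeq fun _ => 1) ≤ mk (X i) := by
      refine mk_ofSeq_le_mk_ofSeq 2 (Filter.Eventually.of_forall fun k => ?_)
      have : x k i ^ 2 ≤ 2 := (Finset.single_le_sum (f := fun i => x k i ^ 2)
        (fun j _ => sq_nonneg _) (Finset.mem_univ i)).trans (hx2 k)
      refine abs_le_of_sq_le_sq ?_ (by norm_num)
      norm_num
      linarith
    exact h2
  · refine hT2.trans_le ?_
    rw [aeval_ofSeq, hT2']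
    refine mk_ofSeq_le_mk_ofSeq (a := fun k => MvPolynomial.eval (x k) f - t k) 2
      (Filter.Eventually.of_forall fun k => hsq k _ ?_)
    have := mul_nonneg (ht4 k).le (hGnn (x k))
    nlinarith [hbound k, sq_nonneg (∑ i, x k i ^ 2 - 1)]
  · refine hT2.trans_le ?_
    have h1 : ∑ i, X i ^ 2 - 1 = Hyperreal.ofSeq fun k => ∑ i, x k i ^ 2 - 1 := by
      have := aeval_ofSeq x (spherePoly σ)
      simp only [eval_spherePoly] at this
      rw [← this]
      simp [spherePoly, hX]
    rw [h1, hT2']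
    refine mk_ofSeq_le_mk_ofSeq 2 (Filter.Eventually.of_forall fun k => hsq k _ ?_)
    have := mul_nonneg (ht4 k).le (hGnn (x k))
    nlinarith [hbound k, sq_nonneg (MvPolynomial.eval (x k) f - t k)]
  · intro i N hN
    have h1 : MvPolynomial.aeval X (MvPolynomial.pderiv i f) - MvPolynomial.aeval X
        (∑ j, MvPolynomial.X j * MvPolynomial.pderiv j f) * X i =
        Hyperreal.ofSeq fun k => MvPolynomial.eval (x k) (tangentialGrad f i) := by
      rw [← aeval_ofSeq, tangentialGrad, map_sub, map_mul, MvPolynomial.aeval_X]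
    rw [h1]
    refine mk_ofSeq_le_mk_ofSeq (a := fun k => MvPolynomial.eval (x k) (tangentialGrad f i) ^ (2 * N))
      (b := fun k => t k ^ (2 * N - 1)) (2 ^ N) ?_
    filter_upwards [Filter.eventually_ge_atTop N] with k hk
    rw [abs_of_nonneg ((even_two_mul N).pow_nonneg _), abs_of_nonneg (pow_nonneg (ht0 k).le _),
      pow_mul]
    have h2 : MvPolynomial.eval (x k) (tangentialGrad f i) ^ 2 ≤
        MvPolynomial.eval (y k) (tangentialNormSq f) + t k ^ 4 := by
      refine le_trans ?_ (hGx k)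
      rw [eval_tangentialNormSq]
      exact Finset.single_le_sum (f := fun i => MvPolynomial.eval (x k) (tangentialGrad f i) ^ 2)
        (fun j _ => sq_nonneg _) (Finset.mem_univ i)
    have h3 : (t k ^ 4) ^ N ≤ t k ^ (2 * N - 1) := by
      rw [← pow_mul]
      exact pow_le_pow_of_le_one (ht0 k).le ((ht1 k).trans (by norm_num)) (by omega)
    calc (MvPolynomial.eval (x k) (tangentialGrad f i) ^ 2) ^ N
        ≤ (MvPolynomial.eval (y k) (tangentialNormSq f) + t k ^ 4) ^ N :=
          pow_le_pow_left₀ (sq_nonneg _) h2 N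
      _ ≤ 2 ^ (N - 1) * (MvPolynomial.eval (y k) (tangentialNormSq f) ^ N + (t k ^ 4) ^ N) :=
          add_pow_le (hGnn _) (ht4 k).le N
      _ ≤ 2 ^ (N - 1) * (t k ^ (2 * N - 1) + t k ^ (2 * N - 1)) := by
          gcongr
          exact hsmall N k (by omega)
      _ = ((2 ^ N : ℕ) : ℝ) * t k ^ (2 * N - 1) := by
          obtain ⟨N, rfl⟩ : ∃ a, N = a + 1 := ⟨N - 1, by omega⟩
          push_cast
          ring

end Lojasiewicz

/-! ### Calculus of tensor contractions. -/

section Contraction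

variable {m n : ℕ}

/-- The index `l` sits at position `r` in either grouping; this underlies the recursion that
contracts one mode at a time. -/
theorem joinIndex_snoc {r : ℕ} (hr : r < m) (i : Fin r → Fin n) (l : Fin n)
    (j : Fin (m - (r + 1)) → Fin n) :
    joinIndex (m := m) (r + 1) (Fin.snoc i l) j =
      joinIndex r i (fun t => (Fin.cons l j : Fin (m - (r + 1) + 1) → Fin n)
        (t.cast (by omega))) := by
  funext t
  unfold joinIndex
  rcases lt_trichotomy (t : ℕ) r with h | h | h
  · rw [dif_pos (by omega : (t : ℕ) < r + 1), dif_pos h]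
    exact Fin.snoc_castSucc (α := fun _ => Fin n) l i ⟨t, h⟩
  · rw [dif_pos (by omega : (t : ℕ) < r + 1), dif_neg (by omega)]
    have h1 : (⟨t, by omega⟩ : Fin (r + 1)) = Fin.last r := Fin.ext h
    have h2 : (⟨(t : ℕ) - r, by omega⟩ : Fin (m - r)).cast (by omega) =
      (0 : Fin (m - (r + 1) + 1)) := Fin.ext (by simp; omega)
    rw [h1, Fin.snoc_last]
    exact (congrArg (Fin.cons l j : Fin (m - (r + 1) + 1) → Fin n) h2).symm
  · rw [dif_neg (by omega), dif_neg (by omega)]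
    have h2 : (⟨(t : ℕ) - r, by omega⟩ : Fin (m - r)).cast (by omega) =
      (⟨(t : ℕ) - (r + 1), by omega⟩ : Fin (m - (r + 1))).succ := Fin.ext (by simp; omega)
    exact (congrArg (Fin.cons l j : Fin (m - (r + 1) + 1) → Fin n) h2).symm

/-- Contracting one more mode. -/
theorem contract_eq_sum_snoc {r : ℕ} (hr : r < m) (A : Tensor m n) (x : EuclideanSpace ℝ (Fin n))
    (i : Fin r → Fin n) :
    contract r A x i = ∑ l, contract (r + 1) A x (Fin.snoc i l) * x l := by
  unfold contract
  simp_rw [Finset.sum_mul]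
  rw [← Fintype.sum_prod_type']
  symm
  refine Fintype.sum_equiv ((Fin.consEquiv fun _ => Fin n).trans
    (Equiv.arrowCongr (finCongr (by omega : m - (r + 1) + 1 = m - r)) (Equiv.refl _))) _ _ ?_
  rintro ⟨l, j⟩
  rw [joinIndex_snoc hr]
  have h : ∀ g : Fin (m - r) → ℝ, ∏ t, g t =
      g (Fin.cast (by omega) (0 : Fin (m - (r + 1) + 1))) *
        ∏ t : Fin (m - (r + 1)), g (Fin.cast (by omega) t.succ) := by
    intro g
    rw [← (finCongr (by omega : m - (r + 1) + 1 = m - r)).prod_comp, Fin.prod_univ_succ]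
    rfl
  rw [h]
  simp [Equiv.arrowCongr, Function.comp_def]
  ring

/-- Contractions of a symmetric tensor are symmetric in the last two indices. -/
theorem contract_snoc_snoc_comm {r : ℕ} (hr : r + 2 ≤ m) {A : Tensor m n} (hA : IsSymmetric A)
    (x : EuclideanSpace ℝ (Fin n)) (i : Fin r → Fin n) (l l' : Fin n) :
    contract (r + 2) A x (Fin.snoc (Fin.snoc i l : Fin (r + 1) → Fin n) l') =
      contract (r + 2) A x (Fin.snoc (Fin.snoc i l' : Fin (r + 1) → Fin n) l) := by
  unfold contract
  refine Finset.sum_congr rfl fun j _ => ?_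
  congr 1
  rw [← hA (Equiv.swap ⟨r, by omega⟩ ⟨r + 1, by omega⟩)]
  congr 1
  funext t
  have e1 : ∀ (a b : Fin n) (h : r < r + 2),
      (Fin.snoc (Fin.snoc i a : Fin (r + 1) → Fin n) b : Fin (r + 2) → Fin n) ⟨r, h⟩ = a := by
    intro a b h
    have : (⟨r, h⟩ : Fin (r + 2)) = (Fin.last r).castSucc := rfl
    rw [this, Fin.snoc_castSucc, Fin.snoc_last]
  have e2 : ∀ (a b : Fin n) (h : r + 1 < r + 2),
      (Fin.snoc (Fin.snoc i a : Fin (r + 1) → Fin n) b : Fin (r + 2) → Fin n) ⟨r + 1, h⟩ = b := by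
    intro a b h
    have : (⟨r + 1, h⟩ : Fin (r + 2)) = Fin.last (r + 1) := rfl
    rw [this, Fin.snoc_last]
  rw [Function.comp_apply]
  rcases eq_or_ne t ⟨r, by omega⟩ with rfl | h1
  · rw [Equiv.swap_apply_left]
    simp [joinIndex, e1, e2]
  rcases eq_or_ne t ⟨r + 1, by omega⟩ with rfl | h2
  · rw [Equiv.swap_apply_right]
    simp [joinIndex, e1, e2]
  rw [Equiv.swap_apply_of_ne_of_ne h1 h2]
  unfold joinIndex
  split_ifs with h
  · have hlt : (t : ℕ) < r := by
      have : (t : ℕ) ≠ r := fun h => h1 (Fin.ext h)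
      have : (t : ℕ) ≠ r + 1 := fun h => h2 (Fin.ext h)
      omega
    have : (⟨t, h⟩ : Fin (r + 2)) = (⟨t, hlt⟩ : Fin r).castSucc.castSucc := rfl
    rw [this, Fin.snoc_castSucc, Fin.snoc_castSucc, Fin.snoc_castSucc, Fin.snoc_castSucc]
  · rfl

/-- The derivative of a contraction of a symmetric tensor along a line. -/
theorem hasDerivAt_contract {A : Tensor m n} (hA : IsSymmetric A)
    (x v : EuclideanSpace ℝ (Fin n)) (s : ℝ) {r : ℕ} (hr : r ≤ m) (i : Fin r → Fin n) :
    HasDerivAt (fun s : ℝ => contract r A (x + s • v) i)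
      (((m : ℝ) - r) * ∑ l, contract (r + 1) A (x + s • v) (Fin.snoc i l) * v l) s := by
  obtain ⟨d, hd⟩ : ∃ d, m = r + d := ⟨m - r, by omega⟩
  induction d generalizing r with
  | zero =>
    have hrm : r = m := by omega
    subst hrm
    have h : (fun s : ℝ => contract r A (x + s • v) i) = fun _ => contract r A x i := by
      funext s
      unfold contract
      refine Finset.sum_congr rfl fun j _ => ?_
      congr 1
      have : IsEmpty (Fin (r - r)) := by rw [Nat.sub_self]; infer_instance
      rw [Fintype.prod_empty, Fintype.prod_empty]
    rw [h, sub_self, zero_mul]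
    exact hasDerivAt_const _ _
  | succ d ih =>
    have hrm : r < m := by omega
    have h1 : ∀ l, HasDerivAt (fun s : ℝ => contract (r + 1) A (x + s • v) (Fin.snoc i l) *
        (x + s • v) l) _ s := fun l =>
      (ih (by omega) (Fin.snoc i l) (by omega)).mul
        (by simpa using ((hasDerivAt_id s).mul_const (v l)).const_add (x l) :
          HasDerivAt (fun s : ℝ => (x + s • v) l) (v l) s)
    have h2 := HasDerivAt.fun_sum (u := Finset.univ) fun l _ => h1 l
    simp_rw [contract_eq_sum_snoc hrm]
    refine h2.congr_deriv ?_
    rw [Finset.sum_add_distrib]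
    -- If `r + 1 = m`, the contraction at `r + 2 > m` is meaningless, but its coefficient `m - (r +
    -- 1)` is zero.
    rcases Nat.eq_zero_or_pos d with rfl | hdpos
    · have : (m : ℝ) = r + 1 := by rw [hd]; push_cast; ring
      simp [this]
    -- Symmetry allows the two new indices to be exchanged, so the inner derivative contributes `m -
    -- r - 1` copies of the sum that the product rule yields once from the factor `x l`.
    have h3 : ∑ l, (((m : ℝ) - ((r + 1 : ℕ) : ℝ)) * ∑ l', contract (r + 1 + 1) A (x + s • v)
          (Fin.snoc (Fin.snoc i l : Fin (r + 1) → Fin n) l') * v l') * (x + s • v) l =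
        ((m : ℝ) - ((r + 1 : ℕ) : ℝ)) *
          ∑ l, contract (r + 1) A (x + s • v) (Fin.snoc i l) * v l := by
      simp_rw [mul_assoc, ← Finset.mul_sum]
      congr 1
      simp_rw [Finset.sum_mul]
      rw [Finset.sum_comm]
      refine Finset.sum_congr rfl fun l' _ => ?_
      rw [contract_eq_sum_snoc (by omega : r + 1 < m), Finset.sum_mul]
      refine Finset.sum_congr rfl fun l _ => ?_
      rw [contract_snoc_snoc_comm (by omega) hA]
      ring
    rw [h3]
    push_cast
    ring

theorem contract_smul (r : ℕ) (A : Tensor m n) (c : ℝ) (x : EuclideanSpace ℝ (Fin n))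
    (i : Fin r → Fin n) : contract r A (c • x) i = c ^ (m - r) * contract r A x i := by
  unfold contract
  rw [Finset.mul_sum]
  refine Finset.sum_congr rfl fun j _ => ?_
  simp [Finset.prod_mul_distrib]
  ring

theorem continuous_contract (r : ℕ) (A : Tensor m n) (i : Fin r → Fin n) :
    Continuous fun x => contract r A x i := by
  unfold contract
  fun_prop

theorem snoc_empty (i : Fin 0 → Fin n) (l : Fin n) : (Fin.snoc i l : Fin 1 → Fin n) = ![l] := by
  funext t
  fin_cases t
  rfl

theorem snoc_singleton (k l : Fin n) : (Fin.snoc ![k] l : Fin 2 → Fin n) = ![k, l] := by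
  funext t
  fin_cases t <;> rfl

theorem rayleigh_eq_inner (hm : 1 ≤ m) (A : Tensor m n) (x : EuclideanSpace ℝ (Fin n)) :
    rayleigh A x = inner ℝ (contractVec A x) x := by
  rw [rayleigh, contract_eq_sum_snoc (by omega)]
  simp [PiLp.inner_apply, contractVec, snoc_empty, mul_comm]

/-- The quadratic form of the matrix `A x^{m-2}`. -/
def contractForm (A : Tensor m n) (x v : EuclideanSpace ℝ (Fin n)) : ℝ :=
  ∑ k, (∑ l, contractMat A x k l * v l) * v k

theorem rayleigh_eq_contractForm (hm : 2 ≤ m) (A : Tensor m n) (x : EuclideanSpace ℝ (Fin n)) :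
    rayleigh A x = contractForm A x x := by
  rw [rayleigh, contract_eq_sum_snoc (by omega)]
  refine Finset.sum_congr rfl fun k _ => ?_
  rw [contract_eq_sum_snoc (by omega), snoc_empty]
  simp_rw [snoc_singleton]
  rfl

theorem contractMat_comm (hm : 2 ≤ m) {A : Tensor m n} (hA : IsSymmetric A)
    (x : EuclideanSpace ℝ (Fin n)) (k l : Fin n) : contractMat A x k l = contractMat A x l k := by
  have := contract_snoc_snoc_comm (r := 0) (by omega) hA x ![] k l
  rw [snoc_empty, snoc_empty] at this
  erw [snoc_singleton, snoc_singleton] at this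
  exact this

theorem hasDerivAt_rayleigh {A : Tensor m n} (hA : IsSymmetric A)
    (x v : EuclideanSpace ℝ (Fin n)) (s : ℝ) :
    HasDerivAt (fun s : ℝ => rayleigh A (x + s • v))
      (m * inner ℝ (contractVec A (x + s • v)) v) s := by
  refine (hasDerivAt_contract hA x v s (Nat.zero_le m) ![]).congr_deriv ?_
  simp [PiLp.inner_apply, contractVec, snoc_empty, mul_comm]

theorem hasDerivAt_inner_contractVec (hm : 1 ≤ m) {A : Tensor m n} (hA : IsSymmetric A)
    (x v : EuclideanSpace ℝ (Fin n)) (s : ℝ) :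
    HasDerivAt (fun s : ℝ => inner ℝ (contractVec A (x + s • v)) v)
      (((m : ℝ) - 1) * contractForm A (x + s • v) v) s := by
  have h : ∀ k, HasDerivAt (fun s : ℝ => contract 1 A (x + s • v) ![k] * v k) _ s := fun k =>
    (hasDerivAt_contract hA x v s hm ![k]).mul_const (v k)
  have h2 := HasDerivAt.fun_sum (u := Finset.univ) fun k _ => h k
  have e : (fun s : ℝ => inner ℝ (contractVec A (x + s • v)) v) =
      fun s : ℝ => ∑ k, contract 1 A (x + s • v) ![k] * v k := by
    funext s
    simp [PiLp.inner_apply, contractVec, mul_comm]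
  rw [e]
  refine h2.congr_deriv ?_
  rw [contractForm, Finset.mul_sum]
  refine Finset.sum_congr rfl fun k _ => ?_
  simp_rw [snoc_singleton]
  simp [contractMat, mul_assoc]

theorem continuous_contractVec (A : Tensor m n) : Continuous (contractVec A) := by
  unfold contractVec
  refine (PiLp.continuous_toLp 2 _).comp (continuous_pi fun i => ?_)
  exact continuous_contract 1 A ![i]

theorem continuous_rayleigh (A : Tensor m n) : Continuous (rayleigh A) :=
  continuous_contract 0 A ![]

/-- The polynomial `A x^m`. -/
def rayleighPoly (A : Tensor m n) : MvPolynomial (Fin n) ℝ :=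
  ∑ i : Fin m → Fin n, MvPolynomial.C (A i) * ∏ t, MvPolynomial.X (i t)

theorem eval_rayleighPoly (A : Tensor m n) (x : EuclideanSpace ℝ (Fin n)) :
    MvPolynomial.eval x (rayleighPoly A) = rayleigh A x := by
  simp only [rayleighPoly, map_sum, map_mul, MvPolynomial.eval_C, map_prod, MvPolynomial.eval_X]
  rfl

/-- Both sides are the derivative along a coordinate line, so uniqueness of derivatives replaces a
combinatorial computation. -/
theorem eval_pderiv_rayleighPoly {A : Tensor m n} (hA : IsSymmetric A)
    (x : EuclideanSpace ℝ (Fin n)) (j : Fin n) :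
    MvPolynomial.eval x (MvPolynomial.pderiv j (rayleighPoly A)) = m * contractVec A x j := by
  classical
  have h1 := hasDerivAt_rayleigh hA x (EuclideanSpace.single j 1) 0
  have h2 := hasDerivAt_eval_line (rayleighPoly A) x (Pi.single j 1) 0
  have e : (fun s : ℝ => MvPolynomial.eval (fun i => x i + s * (Pi.single j (1 : ℝ) : Fin n → ℝ) i)
      (rayleighPoly A)) = fun s : ℝ => rayleigh A (x + s • EuclideanSpace.single j 1) := by
    funext s
    rw [← eval_rayleighPoly]
    congr 2
  rw [e] at h2
  have := h2.unique h1
  simpa [Pi.single_apply, EuclideanSpace.inner_single_right] using this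

end Contraction

/-! ### Lower bounds for the quadratic forms in terms of `beta`. -/

section SpectralBound

variable {m n : ℕ}

/-- Used to exclude the default values in `beta`: `toReal` sends `⊤` to `0`, and the real `sSup` of
an unbounded set is `0`. -/
theorem spectralRadius_le_linftyOpNorm [Nonempty (Fin n)] (M : Matrix (Fin n) (Fin n) ℝ) :
    spectralRadius ℝ M ≤ (Finset.univ.sup fun i => ∑ j, ‖M i j‖₊ : NNReal) := by
  let _ := Matrix.linftyOpNormedRing (n := Fin n) (α := ℝ)
  let _ := Matrix.linftyOpNormedAlgebra (n := Fin n) (R := ℝ) (α := ℝ)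
  have := spectrum.spectralRadius_le_nnnorm (𝕜 := ℝ) M
  rwa [Matrix.linfty_opNNNorm_def] at this

theorem spectralRadius_ne_top [Nonempty (Fin n)] (M : Matrix (Fin n) (Fin n) ℝ) :
    spectralRadius ℝ M ≠ ⊤ :=
  ne_top_of_le_ne_top ENNReal.coe_ne_top (spectralRadius_le_linftyOpNorm M)

/-- Adding `ρ` to a Hermitian matrix moves its spectrum into `[0, ∞)`, which makes it positive
semidefinite. -/
theorem neg_spectralRadius_mul_le [Nonempty (Fin n)] {M : Matrix (Fin n) (Fin n) ℝ}
    (hM : ∀ i j, M i j = M j i) (v : EuclideanSpace ℝ (Fin n)) :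
    -(spectralRadius ℝ M).toReal * ‖v‖ ^ 2 ≤ ∑ k, (∑ l, M k l * v l) * v k := by
  set ρ := (spectralRadius ℝ M).toReal with hρ
  have hH : M.IsHermitian := by
    ext i j
    simp [hM j i]
  have hpsd : (M + algebraMap ℝ (Matrix (Fin n) (Fin n) ℝ) ρ).PosSemidef := by
    rw [Matrix.posSemidef_iff_isHermitian_and_spectrum_nonneg]
    refine ⟨hH.add ?_, ?_⟩
    · rw [Matrix.algebraMap_eq_diagonal]
      exact Matrix.isHermitian_diagonal _
    · rw [← spectrum.add_singleton_eq]
      rintro _ ⟨μ, hμ, _, rfl, rfl⟩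
      have h1 : (‖μ‖₊ : ENNReal) ≤ spectralRadius ℝ M :=
        le_iSup₂ (f := fun k (_ : k ∈ spectrum ℝ M) => (‖k‖₊ : ENNReal)) μ hμ
      have h2 : |μ| ≤ ρ := by
        have := ENNReal.toReal_mono (spectralRadius_ne_top M) h1
        simpa using this
      have := neg_abs_le μ
      show 0 ≤ μ + ρ
      linarith
  have h := hpsd.dotProduct_mulVec_nonneg v
  rw [Matrix.add_mulVec, dotProduct_add, Matrix.algebraMap_eq_diagonal] at h
  have h1 : star (v : Fin n → ℝ) ⬝ᵥ (M.mulVec v) = ∑ k, (∑ l, M k l * v l) * v k := by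
    simp [dotProduct, Matrix.mulVec, mul_comm]
  have h2 : star (v : Fin n → ℝ) ⬝ᵥ
      ((Matrix.diagonal ((algebraMap ℝ (Fin n → ℝ)) ρ)).mulVec v) = ρ * ‖v‖ ^ 2 := by
    rw [EuclideanSpace.real_norm_sq_eq, Finset.mul_sum]
    simp only [dotProduct, Matrix.mulVec_diagonal]
    refine Finset.sum_congr rfl fun i _ => ?_
    simp
    ring
  rw [h1, h2] at h
  linarith

theorem spectralRadius_le_beta [Nonempty (Fin n)] (hm : 1 ≤ m) (E : Tensor m n)
    {u : EuclideanSpace ℝ (Fin n)} (hu : ‖u‖ = 1) :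
    ((m : ℝ) - 1) * (spectralRadius ℝ (contractMat E u)).toReal ≤ beta E := by
  have hm1 : (1 : ℝ) ≤ m := by exact_mod_cast hm
  refine mul_le_mul_of_nonneg_left (le_csSup ?_ ⟨u, by simpa using hu, rfl⟩) (by linarith)
  have hcont : Continuous fun x => ∑ i, ∑ j, ‖contractMat E x i j‖ := by
    refine continuous_finsetSum _ fun i _ => continuous_finsetSum _ fun j _ => ?_
    exact (continuous_contract 2 E ![i, j]).norm
  obtain ⟨C, hC⟩ := (isCompact_sphere (0 : EuclideanSpace ℝ (Fin n)) 1).bddAbove_image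
    hcont.continuousOn
  refine ⟨C, ?_⟩
  rintro _ ⟨x, hx, rfl⟩
  refine le_trans ?_ (hC ⟨x, hx, rfl⟩)
  have h1 := ENNReal.toReal_mono ENNReal.coe_ne_top (spectralRadius_le_linftyOpNorm (contractMat E x))
  refine h1.trans ?_
  rw [ENNReal.coe_toReal]
  have h2 : (Finset.univ.sup fun i => ∑ j, ‖contractMat E x i j‖₊ : NNReal) ≤
      ∑ i, ∑ j, ‖contractMat E x i j‖₊ :=
    Finset.sup_le fun i _ => Finset.single_le_sum (f := fun i => ∑ j, ‖contractMat E x i j‖₊)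
      (fun _ _ => zero_le) (Finset.mem_univ i)
  have h3 := NNReal.coe_le_coe.2 h2
  push_cast at h3
  exact h3

theorem beta_nonneg (hm : 1 ≤ m) (E : Tensor m n) : 0 ≤ beta E := by
  have hm1 : (1 : ℝ) ≤ m := by exact_mod_cast hm
  refine mul_nonneg (by linarith) (Real.sSup_nonneg ?_)
  rintro _ ⟨x, _, rfl⟩
  exact ENNReal.toReal_nonneg

/-- On the unit ball the quadratic forms `(m - 1) E x^{m-2}` are bounded below by `-β(E)`. -/
theorem neg_beta_mul_le_contractForm (hm : 2 ≤ m) {E : Tensor m n} (hE : IsSymmetric E)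
    {a : EuclideanSpace ℝ (Fin n)} (ha : ‖a‖ = 1) {x : EuclideanSpace ℝ (Fin n)} (hx : ‖x‖ ≤ 1)
    (v : EuclideanSpace ℝ (Fin n)) :
    -beta E * ‖v‖ ^ 2 ≤ ((m : ℝ) - 1) * contractForm E x v := by
  have hne : Nonempty (Fin n) := by
    by_contra h
    rw [not_nonempty_iff] at h
    rw [Subsingleton.elim a 0, norm_zero] at ha
    exact zero_ne_one ha
  have hm1 : (2 : ℝ) ≤ m := by exact_mod_cast hm
  -- By homogeneity the form at `x` is `‖x‖ ^ (m - 2) ≤ 1` times the form at a unit vector, and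
  -- shrinking preserves the nonpositive bound `-β`. For `x = 0` any unit vector serves, here `a`.
  obtain ⟨u, hu, hxu⟩ : ∃ u : EuclideanSpace ℝ (Fin n), ‖u‖ = 1 ∧ x = ‖x‖ • u := by
    rcases eq_or_ne x 0 with rfl | h
    · exact ⟨a, ha, by simp⟩
    · refine ⟨‖x‖⁻¹ • x, norm_smul_inv_norm h, ?_⟩
      rw [smul_smul, mul_inv_cancel₀ (norm_ne_zero_iff.2 h), one_smul]
  have hscale : contractForm E x v = ‖x‖ ^ (m - 2) * contractForm E u v := by
    have : ∀ k l, contractMat E x k l = ‖x‖ ^ (m - 2) * contractMat E u k l := fun k l => by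
      conv_lhs => rw [hxu]
      exact contract_smul 2 E ‖x‖ u ![k, l]
    simp only [contractForm, this, Finset.mul_sum, mul_assoc, Finset.sum_mul]
  have h1 := neg_spectralRadius_mul_le (contractMat_comm hm hE u) v
  have h2 := spectralRadius_le_beta (by omega) E hu
  have h3 : -beta E * ‖v‖ ^ 2 ≤ ((m : ℝ) - 1) * contractForm E u v := by
    have h4 : ((m : ℝ) - 1) * (-(spectralRadius ℝ (contractMat E u)).toReal * ‖v‖ ^ 2) ≤
        ((m : ℝ) - 1) * contractForm E u v := mul_le_mul_of_nonneg_left h1 (by linarith)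
    nlinarith [sq_nonneg ‖v‖]
  have h5 : 0 ≤ ‖x‖ ^ (m - 2) := by positivity
  have h6 : ‖x‖ ^ (m - 2) ≤ 1 := pow_le_one₀ (norm_nonneg x) hx
  have h7 : 0 ≤ beta E * ‖v‖ ^ 2 := mul_nonneg (beta_nonneg (by omega) E) (sq_nonneg _)
  rw [hscale]
  calc -beta E * ‖v‖ ^ 2 ≤ ‖x‖ ^ (m - 2) * (-beta E * ‖v‖ ^ 2) := by nlinarith
    _ ≤ ‖x‖ ^ (m - 2) * (((m : ℝ) - 1) * contractForm E u v) := mul_le_mul_of_nonneg_left h3 h5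
    _ = _ := by ring

theorem contract_rankOne (a x : EuclideanSpace ℝ (Fin n)) {r : ℕ} (hr : r ≤ m)
    (i : Fin r → Fin n) :
    contract r (rankOne m a) x i = (∏ s, a (i s)) * (∑ l, a l * x l) ^ (m - r) := by
  obtain ⟨d, hd⟩ : ∃ d, m = r + d := ⟨m - r, by omega⟩
  induction d generalizing r with
  | zero =>
    have hrm : r = m := by omega
    subst hrm
    have : IsEmpty (Fin (r - r)) := by rw [Nat.sub_self]; infer_instance
    simp [contract, rankOne, joinIndex]
  | succ d ih =>
    rw [contract_eq_sum_snoc (by omega)]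
    have h1 : ∀ l, ∏ s, a ((Fin.snoc i l : Fin (r + 1) → Fin n) s) = (∏ s, a (i s)) * a l := by
      intro l
      rw [Fin.prod_univ_castSucc]
      simp
    simp_rw [fun l => ih (by omega) (Fin.snoc i l) (by omega), h1]
    rw [show m - r = m - (r + 1) + 1 by omega, pow_succ, ← mul_assoc, Finset.mul_sum]
    refine Finset.sum_congr rfl fun l _ => ?_
    ring

/-- The form is `(a·x) ^ (m - 2) * (a·v) ^ 2`; this is where the parity of `m` enters. -/
theorem contractForm_rankOne_nonneg (hm : 2 ≤ m) (hm_even : Even m)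
    (a x v : EuclideanSpace ℝ (Fin n)) : 0 ≤ contractForm (rankOne m a) x v := by
  have h : contractForm (rankOne m a) x v = (∑ l, a l * x l) ^ (m - 2) * (∑ l, a l * v l) ^ 2 := by
    have h1 : ∀ k l, contractMat (rankOne m a) x k l = a k * a l * (∑ l, a l * x l) ^ (m - 2) :=
      fun k l => by
        have := contract_rankOne a x hm ![k, l]
        rw [Fin.prod_univ_two] at this
        exact this
    simp_rw [contractForm, h1]
    rw [sq, Finset.sum_mul, Finset.mul_sum]
    refine Finset.sum_congr rfl fun k _ => ?_
    rw [Finset.sum_mul, Finset.mul_sum, Finset.mul_sum]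
    refine Finset.sum_congr rfl fun l _ => ?_
    ring
  rw [h]
  exact mul_nonneg (Even.pow_nonneg ((Nat.even_sub hm).2 (by simp [hm_even])) _) (sq_nonneg _)

theorem contractForm_smul_add (c : ℝ) (B E : Tensor m n) (x v : EuclideanSpace ℝ (Fin n)) :
    contractForm (c • B + E) x v = c * contractForm B x v + contractForm E x v := by
  have h : ∀ k l, contractMat (c • B + E) x k l =
      c * contractMat B x k l + contractMat E x k l := fun k l => by
    simp [contractMat, contract, add_mul, Finset.sum_add_distrib, Finset.mul_sum, mul_assoc]
  simp only [contractForm, h, Finset.mul_sum, Finset.sum_mul, ← Finset.sum_add_distrib]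
  exact Finset.sum_congr rfl fun k _ => Finset.sum_congr rfl fun l _ => by ring

theorem isSymmetric_smul_rankOne_add (c : ℝ) (a : EuclideanSpace ℝ (Fin n)) {E : Tensor m n}
    (hE : IsSymmetric E) : IsSymmetric (c • rankOne m a + E) := by
  intro τ i
  have : rankOne m a (i ∘ τ) = rankOne m a i := Equiv.prod_comp τ fun t => a (i t)
  simp [this, hE τ i]

end SpectralBound

/-! ### Quadratic lower bound for the Rayleigh quotient. -/

section Ascent

/-- Second order Taylor estimate on `[0, 1]`. -/
theorem taylor_lower_bound {φ φ' φ'' : ℝ → ℝ} {c : ℝ} (h1 : ∀ s, HasDerivAt φ (φ' s) s)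
    (h2 : ∀ s, HasDerivAt φ' (φ'' s) s) (h3 : ∀ s, 0 ≤ s → s ≤ 1 → c ≤ φ'' s) :
    φ 0 + φ' 0 + c / 2 ≤ φ 1 := by
  have d1 : ∀ s, HasDerivAt (fun s => φ' s - c * s) (φ'' s - c) s := fun s =>
    (h2 s).sub (by simpa using (hasDerivAt_id s).const_mul c)
  have m1 : MonotoneOn (fun s => φ' s - c * s) (Set.Icc 0 1) := by
    refine monotoneOn_of_deriv_nonneg (convex_Icc 0 1)
      (fun s _ => (d1 s).continuousAt.continuousWithinAt)
      (fun s _ => (d1 s).differentiableAt.differentiableWithinAt) fun s hs => ?_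
    rw [interior_Icc] at hs
    rw [(d1 s).deriv]
    linarith [h3 s hs.1.le hs.2.le]
  have d2 : ∀ s, HasDerivAt (fun s => φ s - φ' 0 * s - c / 2 * s ^ 2)
      (φ' s - φ' 0 - c * s) s := fun s => by
    have e1 : HasDerivAt (fun s => φ' 0 * s) (φ' 0) s := by
      simpa using (hasDerivAt_id s).const_mul (φ' 0)
    have e2 : HasDerivAt (fun s : ℝ => c / 2 * s ^ 2) (c * s) s := by
      refine ((hasDerivAt_pow 2 s).const_mul (c / 2)).congr_deriv ?_
      push_cast
      ring
    exact ((h1 s).sub e1).sub e2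
  have m2 : MonotoneOn (fun s => φ s - φ' 0 * s - c / 2 * s ^ 2) (Set.Icc 0 1) := by
    refine monotoneOn_of_deriv_nonneg (convex_Icc 0 1)
      (fun s _ => (d2 s).continuousAt.continuousWithinAt)
      (fun s _ => (d2 s).differentiableAt.differentiableWithinAt) fun s hs => ?_
    rw [interior_Icc] at hs
    rw [(d2 s).deriv]
    have := m1 (Set.left_mem_Icc.2 zero_le_one) ⟨hs.1.le, hs.2.le⟩ hs.1.le
    simp only [mul_zero, sub_zero] at this
    linarith
  have := m2 (Set.left_mem_Icc.2 zero_le_one) (Set.right_mem_Icc.2 zero_le_one) zero_le_one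
  norm_num at this
  linarith

variable {m n : ℕ}

/-- The chord stays in the unit ball, so Taylor's formula applies with the bound `-β`. For unit
vectors `⟨x, y - x⟩ = -‖y - x‖² / 2`, so putting the shift `α` into the gradient is compensated by
the quadratic term `m α / 2 ‖y - x‖²`. -/
theorem rayleigh_add_le (hm : 1 ≤ m) {A : Tensor m n} (hA : IsSymmetric A) {β : ℝ}
    (hβ : ∀ x : EuclideanSpace ℝ (Fin n), ‖x‖ ≤ 1 → ∀ v,
      -β * ‖v‖ ^ 2 ≤ ((m : ℝ) - 1) * contractForm A x v) (α : ℝ)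
    {x y : EuclideanSpace ℝ (Fin n)} (hx : ‖x‖ = 1) (hy : ‖y‖ = 1) :
    rayleigh A x + m * inner ℝ (shiftedMap A α x) (y - x) + m * (α - β) / 2 * ‖y - x‖ ^ 2 ≤
      rayleigh A y := by
  have hball : ∀ s : ℝ, 0 ≤ s → s ≤ 1 → ‖x + s • (y - x)‖ ≤ 1 := by
    intro s h0 h1
    have : x + s • (y - x) = (1 - s) • x + s • y := by
      rw [smul_sub, sub_smul, one_smul]; abel
    rw [this]
    refine (norm_add_le _ _).trans ?_
    rw [norm_smul, norm_smul, hx, hy, Real.norm_of_nonneg h0, Real.norm_of_nonneg (by linarith)]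
    linarith
  have h := taylor_lower_bound (c := (m : ℝ) * (-β * ‖y - x‖ ^ 2))
    (fun s => hasDerivAt_rayleigh hA x (y - x) s)
    (fun s => (hasDerivAt_inner_contractVec hm hA x (y - x) s).const_mul (m : ℝ))
    (fun s h0 h1 => mul_le_mul_of_nonneg_left (hβ _ (hball s h0 h1) _) (Nat.cast_nonneg m))
  simp only [zero_smul, add_zero, one_smul, add_sub_cancel] at h
  have h2 : inner ℝ x (y - x) = -(1 / 2) * ‖y - x‖ ^ 2 := by
    rw [inner_sub_right, real_inner_self_eq_norm_sq, hx, norm_sub_sq_real, hx, hy,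
      real_inner_comm]
    ring
  rw [shiftedMap, inner_add_left, real_inner_smul_left, h2]
  linarith

end Ascent

/-! ### Finite length of the iteration and identification of the limit. -/

section Convergence

/-- A sequence whose steps are dominated by the decrease of a nonnegative sequence converges. -/
theorem exists_tendsto_of_dist_le {X : Type*} [MetricSpace X] [CompleteSpace X] {x : ℕ → X}
    {u : ℕ → ℝ} (hu : ∀ k, 0 ≤ u k) {k₀ : ℕ}
    (h : ∀ k, k₀ ≤ k → dist (x k) (x (k + 1)) ≤ u k - u (k + 1)) :
    ∃ z, Filter.Tendsto x Filter.atTop (nhds z) := by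
  have hsum : Summable fun k => dist (x (k + k₀)) (x (k + 1 + k₀)) := by
    refine summable_of_sum_range_le (c := u k₀) (fun _ => dist_nonneg) fun N => ?_
    calc ∑ k ∈ Finset.range N, dist (x (k + k₀)) (x (k + 1 + k₀))
        ≤ ∑ k ∈ Finset.range N, (u (k + k₀) - u (k + 1 + k₀)) :=
          Finset.sum_le_sum fun k _ => by
            rw [show k + 1 + k₀ = k + k₀ + 1 by omega]
            exact h _ (by omega)
      _ = u k₀ - u (N + k₀) := by
          rw [Finset.sum_range_sub' (fun k => u (k + k₀))]
          simp
      _ ≤ u k₀ := by linarith [hu (N + k₀)]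
  obtain ⟨z, hz⟩ := cauchySeq_tendsto_of_complete
    (cauchySeq_of_summable_dist (f := fun k => x (k + k₀)) hsum)
  exact ⟨z, (Filter.tendsto_add_atTop_iff_nat k₀).1 hz⟩

/-- Concavity of `s ↦ s ^ p`, from Bernoulli's inequality at `s / t`. -/
theorem mul_sub_le_rpow_sub_rpow {s t p : ℝ} (hs : 0 ≤ s) (ht : 0 < t) (hp0 : 0 ≤ p)
    (hp1 : p ≤ 1) : p * (t - s) ≤ t ^ (1 - p) * (t ^ p - s ^ p) := by
  have hb := rpow_one_add_le_one_add_mul_self (s := s / t - 1)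
    (by have : 0 ≤ s / t := by positivity
        linarith) hp0 hp1
  rw [add_sub_cancel, Real.div_rpow hs ht.le, div_le_iff₀ (Real.rpow_pos_of_pos ht p)] at hb
  have h1 : t ^ (1 - p) * t ^ p = t := by
    rw [← Real.rpow_add ht, sub_add_cancel, Real.rpow_one]
  have h2 := mul_le_mul_of_nonneg_left hb (Real.rpow_nonneg ht.le (1 - p))
  have h3 : t ^ (1 - p) * ((1 + p * (s / t - 1)) * t ^ p) = t + p * (s - t) := by
    calc t ^ (1 - p) * ((1 + p * (s / t - 1)) * t ^ p)
        = (t ^ (1 - p) * t ^ p) * (1 + p * (s / t - 1)) := by ring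
      _ = t + p * (s - t) := by
          rw [h1]
          field_simp
  rw [h3] at h2
  rw [mul_sub (t ^ (1 - p)), h1]
  linarith

/-- Convergence of a descent sequence satisfying a Łojasiewicz inequality. -/
theorem exists_tendsto_of_lojasiewicz {X : Type*} [MetricSpace X] [CompleteSpace X] {x : ℕ → X}
    {t : ℕ → ℝ} (ht : ∀ k, 0 < t k) {c C : ℝ} (hc : 0 < c) (hC : 0 < C) {N : ℕ} (hN : 1 ≤ N)
    (hdesc : ∀ k, c * dist (x k) (x (k + 1)) ^ 2 ≤ t k - t (k + 1)) {k₀ : ℕ}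
    (hloj : ∀ k, k₀ ≤ k → t k ^ (2 * N - 1) ≤ (C * dist (x k) (x (k + 1))) ^ (2 * N)) :
    ∃ z, Filter.Tendsto x Filter.atTop (nhds z) := by
  -- With this exponent the hypothesis reads `t k ^ (1 - p) ≤ C d`. Concavity turns `c d ^ 2 ≤ t k -
  -- t (k + 1)` into a bound on `d` by the decrease of `C / (c p) * t ^ p`, after cancelling one
  -- factor `d`.
  set p : ℝ := 1 / (2 * N) with hp
  have hN' : (1 : ℝ) ≤ N := by exact_mod_cast hN
  have hp0 : 0 < p := by positivity
  have hp1 : p ≤ 1 := by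
    rw [hp, div_le_one (by positivity)]
    linarith
  refine exists_tendsto_of_dist_le (u := fun k => C / (c * p) * t k ^ p) (k₀ := k₀)
    (fun k => mul_nonneg (by positivity) (Real.rpow_nonneg (ht k).le _)) fun k hk => ?_
  set d := dist (x k) (x (k + 1)) with hd
  have hd0 : 0 ≤ d := dist_nonneg
  have h1 : t k ^ (1 - p) ≤ C * d := by
    have h := Real.rpow_le_rpow (by have := ht k; positivity) (hloj k hk) hp0.le
    rw [← Real.rpow_natCast, ← Real.rpow_natCast, ← Real.rpow_mul (ht k).le,
      ← Real.rpow_mul (by positivity)] at h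
    have e1 : ((2 * N - 1 : ℕ) : ℝ) * p = 1 - p := by
      rw [Nat.cast_sub (by omega), hp]
      push_cast
      field_simp
    have e2 : ((2 * N : ℕ) : ℝ) * p = 1 := by
      rw [hp]
      push_cast
      field_simp
    rwa [e1, e2, Real.rpow_one] at h
  have hpos : 0 < t k ^ (1 - p) := Real.rpow_pos_of_pos (ht k) _
  have hdpos : 0 < d := by
    by_contra! hcon
    have : d = 0 := le_antisymm hcon hd0
    rw [this, mul_zero] at h1
    linarith
  have h2 := mul_sub_le_rpow_sub_rpow (ht (k + 1)).le (ht k) hp0.le hp1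
  have hmono : 0 ≤ t k ^ p - t (k + 1) ^ p := by
    have h3 := hdesc k
    have h4 : t (k + 1) ≤ t k := by nlinarith [mul_nonneg hc.le (sq_nonneg d)]
    exact sub_nonneg.2 (Real.rpow_le_rpow (ht (k + 1)).le h4 hp0.le)
  have h5 : p * (c * d ^ 2) ≤ C * d * (t k ^ p - t (k + 1) ^ p) :=
    (mul_le_mul_of_nonneg_left (hdesc k) hp0.le).trans
      (h2.trans (mul_le_mul_of_nonneg_right h1 hmono))
  have h6 : p * c * d ≤ C * (t k ^ p - t (k + 1) ^ p) := by
    refine le_of_mul_le_mul_right ?_ hdpos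
    nlinarith
  rw [← mul_sub, div_mul_eq_mul_div, le_div_iff₀ (by positivity)]
  linarith

variable {m n : ℕ}

/-- The component of `A x^{m-1}` orthogonal to `x`, for `‖x‖ = 1`. -/
def tangentialVec (A : Tensor m n) (x : EuclideanSpace ℝ (Fin n)) : EuclideanSpace ℝ (Fin n) :=
  contractVec A x - inner ℝ (contractVec A x) x • x

theorem continuous_tangentialVec (A : Tensor m n) : Continuous (tangentialVec A) := by
  have := continuous_contractVec A
  unfold tangentialVec
  fun_prop

theorem continuous_shiftedMap (A : Tensor m n) (α : ℝ) : Continuous (shiftedMap A α) := by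
  have := continuous_contractVec A
  unfold shiftedMap
  fun_prop

theorem eval_tangentialNormSq_rayleighPoly {A : Tensor m n} (hA : IsSymmetric A) (c : ℝ)
    (x : EuclideanSpace ℝ (Fin n)) :
    MvPolynomial.eval x (tangentialNormSq (MvPolynomial.C c - rayleighPoly A)) =
      (m * ‖tangentialVec A x‖) ^ 2 := by
  rw [eval_tangentialNormSq, mul_pow, EuclideanSpace.real_norm_sq_eq, Finset.mul_sum]
  refine Finset.sum_congr rfl fun i _ => ?_
  have h1 : ∀ j, MvPolynomial.eval x (MvPolynomial.pderiv j (MvPolynomial.C c - rayleighPoly A)) =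
      -(m * contractVec A x j) := fun j => by
    rw [map_sub, MvPolynomial.pderiv_C, zero_sub, map_neg, eval_pderiv_rayleighPoly hA]
  have h2 : inner ℝ (contractVec A x) x = ∑ j, x j * contractVec A x j := by
    simp [PiLp.inner_apply]
  simp only [tangentialGrad, map_sub, map_mul, map_sum, MvPolynomial.eval_X] at h1 ⊢
  simp only [h1, tangentialVec, h2, PiLp.sub_apply, PiLp.smul_apply, smul_eq_mul]
  have h3 : ∑ j, x j * -(m * contractVec A x j) = -(m * ∑ j, x j * contractVec A x j) := by
    rw [Finset.mul_sum, ← Finset.sum_neg_distrib]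
    exact Finset.sum_congr rfl fun j _ => by ring
  rw [h3]
  ring

/-- The shift drops out of the tangential part, which is `g` minus its projection onto the line of
`x`. The projection minimizes the distance to that line, on which `‖g‖ • x` also lies. -/
theorem norm_tangentialVec_le (A : Tensor m n) (α : ℝ) {x : EuclideanSpace ℝ (Fin n)}
    (hx : ‖x‖ = 1) (hg : shiftedMap A α x ≠ 0) :
    ‖tangentialVec A x‖ ≤
      ‖shiftedMap A α x‖ * ‖‖shiftedMap A α x‖⁻¹ • shiftedMap A α x - x‖ := by
  set g := shiftedMap A α x with hgdef
  have hτ : tangentialVec A x = g - inner ℝ g x • x := by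
    rw [hgdef, shiftedMap, inner_add_left, real_inner_smul_left, real_inner_self_eq_norm_sq, hx,
      tangentialVec, add_smul]
    simp only [one_pow, mul_one]
    abel
  have h1 : ‖g‖ * ‖‖g‖⁻¹ • g - x‖ = ‖g - ‖g‖ • x‖ := by
    rw [← Real.norm_of_nonneg (norm_nonneg g), ← norm_smul, smul_sub, smul_smul]
    simp only [norm_norm]
    rw [mul_inv_cancel₀ (norm_ne_zero_iff.2 hg), one_smul]
  rw [h1, hτ]
  refine le_of_sq_le_sq ?_ (norm_nonneg _)
  rw [norm_sub_sq_real, norm_sub_sq_real, norm_smul, norm_smul, hx, real_inner_smul_right,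
    real_inner_smul_right]
  simp only [mul_one, Real.norm_eq_abs, sq_abs]
  nlinarith [sq_nonneg (inner ℝ g x - ‖g‖)]

theorem isEigenvector_of_tangentialVec_eq_zero {A : Tensor m n} {x : EuclideanSpace ℝ (Fin n)}
    (hx : ‖x‖ = 1) (h : tangentialVec A x = 0) : IsEigenvector A x :=
  ⟨hx, _, sub_eq_zero.1 h⟩

theorem isEigenvector_of_normalize_eq {A : Tensor m n} {α : ℝ} {x : EuclideanSpace ℝ (Fin n)}
    (hx : ‖x‖ = 1) (hg : shiftedMap A α x ≠ 0)
    (h : ‖shiftedMap A α x‖⁻¹ • shiftedMap A α x = x) : IsEigenvector A x := by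
  refine isEigenvector_of_tangentialVec_eq_zero hx (norm_le_zero_iff.1 ?_)
  simpa [h] using norm_tangentialVec_le A α hx hg

/-- The convergence theorem for a symmetric tensor `A` such that `(m - 1) A x^{m-2} + β` is
positive semidefinite for all `x` in the unit ball. -/
theorem ssHopm_converges (hm : 2 ≤ m) {A : Tensor m n} (hA : IsSymmetric A) {α β : ℝ}
    (hβ0 : 0 ≤ β) (hβα : β < α)
    (hβ : ∀ x : EuclideanSpace ℝ (Fin n), ‖x‖ ≤ 1 → ∀ v,
      -β * ‖v‖ ^ 2 ≤ ((m : ℝ) - 1) * contractForm A x v)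
    {x₀ : EuclideanSpace ℝ (Fin n)} (hx₀ : ‖x₀‖ = 1) :
    (∀ k, shiftedMap A α (ssHopm A α x₀ k) ≠ 0) ∧
    (∀ k, rayleigh A (ssHopm A α x₀ k) ≤ rayleigh A (ssHopm A α x₀ (k + 1))) ∧
    (∀ k, ¬ IsEigenvector A (ssHopm A α x₀ k) →
      rayleigh A (ssHopm A α x₀ k) < rayleigh A (ssHopm A α x₀ (k + 1))) ∧
    ∃ x : EuclideanSpace ℝ (Fin n), IsEigenvector A x ∧
      Filter.Tendsto (ssHopm A α x₀) Filter.atTop (nhds x) := by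
  have hm2 : (2 : ℝ) ≤ m := by exact_mod_cast hm
  -- the update never vanishes on the sphere
  have hne : ∀ x : EuclideanSpace ℝ (Fin n), ‖x‖ = 1 → shiftedMap A α x ≠ 0 := by
    intro x hx h0
    have h1 : inner ℝ (shiftedMap A α x) x = rayleigh A x + α := by
      rw [shiftedMap, inner_add_left, real_inner_smul_left, real_inner_self_eq_norm_sq, hx,
        rayleigh_eq_inner (by omega)]
      ring
    rw [h0, inner_zero_left] at h1
    -- At `v = x` the form is the Rayleigh quotient, so `(m - 1) A x^m ≥ -β`; with `A x^m = -α` this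
    -- would give `(m - 1) α ≤ β < α`.
    have h2 := hβ x hx.le x
    rw [← rayleigh_eq_contractForm hm, hx] at h2
    nlinarith
  set x := ssHopm A α x₀ with hxdef
  have hstep : ∀ k, x (k + 1) = ‖shiftedMap A α (x k)‖⁻¹ • shiftedMap A α (x k) := fun k => rfl
  have hunit : ∀ k, ‖x k‖ = 1 := by
    intro k
    induction k with
    | zero => exact hx₀
    | succ k ih =>
      rw [hstep]
      exact norm_smul_inv_norm (𝕜 := ℝ) (hne _ ih)
  have hgne : ∀ k, shiftedMap A α (x k) ≠ 0 := fun k => hne _ (hunit k)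
  set c : ℝ := m * (α - β) / 2 with hc
  have hc0 : 0 < c := by
    have : 0 < α - β := by linarith
    positivity
  have hasc : ∀ k, c * ‖x (k + 1) - x k‖ ^ 2 ≤ rayleigh A (x (k + 1)) - rayleigh A (x k) := by
    intro k
    have h := rayleigh_add_le (by omega) hA hβ α (hunit k) (hunit (k + 1))
    -- With `g` the shifted map at `x k`, the inner product equals `‖g‖ - ⟨g, x k⟩`, nonnegative by
    -- Cauchy–Schwarz.
    have h1 : 0 ≤ inner ℝ (shiftedMap A α (x k)) (x (k + 1) - x k) := by
      rw [inner_sub_right, hstep, real_inner_smul_right, real_inner_self_eq_norm_sq, sq,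
        inv_mul_cancel_left₀ (norm_ne_zero_iff.2 (hgne k))]
      have := real_inner_le_norm (shiftedMap A α (x k)) (x k)
      rw [hunit k, mul_one] at this
      linarith
    have h2 := mul_nonneg (Nat.cast_nonneg (α := ℝ) m) h1
    rw [← hc] at h
    linarith
  have hmono : ∀ k, rayleigh A (x k) ≤ rayleigh A (x (k + 1)) := fun k => by
    have := mul_nonneg hc0.le (sq_nonneg ‖x (k + 1) - x k‖)
    linarith [hasc k]
  have hstrict : ∀ k, ¬ IsEigenvector A (x k) → rayleigh A (x k) < rayleigh A (x (k + 1)) := by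
    intro k hk
    have h1 : x (k + 1) ≠ x k := fun h =>
      hk (isEigenvector_of_normalize_eq (hunit k) (hgne k) ((hstep k).symm.trans h))
    have h2 : 0 < ‖x (k + 1) - x k‖ := norm_pos_iff.2 (sub_ne_zero.2 h1)
    have : 0 < c * ‖x (k + 1) - x k‖ ^ 2 := by positivity
    linarith [hasc k]
  refine ⟨hgne, hmono, hstrict, ?_⟩
  have hsphere : ∀ k, x k ∈ Metric.sphere (0 : EuclideanSpace ℝ (Fin n)) 1 := fun k => by
    simpa using hunit k
  have hcpt := isCompact_sphere (0 : EuclideanSpace ℝ (Fin n)) 1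
  obtain ⟨R, hR⟩ := hcpt.bddAbove_image (continuous_rayleigh A).continuousOn
  obtain ⟨B, hB⟩ := hcpt.bddAbove_image (continuous_shiftedMap A α).norm.continuousOn
  have hBk : ∀ k, ‖shiftedMap A α (x k)‖ ≤ B := fun k => hB ⟨x k, hsphere k, rfl⟩
  have hB0 : 0 < B := (norm_pos_iff.2 (hgne 0)).trans_le (hBk 0)
  have hmon : Monotone fun k => rayleigh A (x k) := monotone_nat_of_le_succ hmono
  have hbdd : BddAbove (Set.range fun k => rayleigh A (x k)) :=
    ⟨R, by rintro _ ⟨k, rfl⟩; exact hR ⟨x k, hsphere k, rfl⟩⟩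
  have hlim := tendsto_atTop_ciSup hmon hbdd
  set L := ⨆ k, rayleigh A (x k) with hL
  have hle : ∀ k, rayleigh A (x k) ≤ L := fun k => le_ciSup hbdd k
  have htan : ∀ k, ‖tangentialVec A (x k)‖ ≤ B * ‖x (k + 1) - x k‖ := by
    intro k
    have h := norm_tangentialVec_le A α (hunit k) (hgne k)
    rw [← hstep] at h
    exact h.trans (mul_le_mul_of_nonneg_right (hBk k) (norm_nonneg _))
  -- the iteration converges
  have hconv : ∃ z, Filter.Tendsto x Filter.atTop (nhds z) := by
    -- The Łojasiewicz inequality needs a strictly positive gap to `L`; if the gap closes at a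
    -- finite step, the iteration is stationary from there on.
    by_cases hstat : ∃ k, rayleigh A (x k) = L
    · obtain ⟨k₀, hk₀⟩ := hstat
      refine exists_tendsto_of_dist_le (u := fun _ => 0) (fun _ => le_rfl) (k₀ := k₀) fun k hk => ?_
      have h1 : L ≤ rayleigh A (x k) := hk₀ ▸ hmon hk
      have h2 := hasc k
      have h3 := hle (k + 1)
      have h4 : ‖x (k + 1) - x k‖ ^ 2 ≤ 0 := by
        by_contra! h
        have := mul_pos hc0 h
        linarith
      rw [dist_comm, dist_eq_norm, sub_self]
      nlinarith [norm_nonneg (x (k + 1) - x k)]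
    · push Not at hstat
      obtain ⟨N, hN, ε, hε, hloj⟩ := exists_lojasiewicz (MvPolynomial.C L - rayleighPoly A)
      have hpos : ∀ k, 0 < L - rayleigh A (x k) := fun k =>
        sub_pos.2 (lt_of_le_of_ne (hle k) (hstat k))
      obtain ⟨k₀, hk₀⟩ := Filter.eventually_atTop.1 (hlim.eventually (lt_mem_nhds (sub_lt_self L hε)))
      refine exists_tendsto_of_lojasiewicz (t := fun k => L - rayleigh A (x k)) hpos hc0
        (C := m * B) (by positivity) hN (fun k => ?_) (k₀ := k₀) fun k hk => ?_
      · rw [dist_comm, dist_eq_norm]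
        linarith [hasc k]
      · have hev : MvPolynomial.eval (x k) (MvPolynomial.C L - rayleighPoly A) =
            L - rayleigh A (x k) := by
          rw [map_sub, MvPolynomial.eval_C, eval_rayleighPoly]
        have h := hloj (x k) (by rw [← EuclideanSpace.real_norm_sq_eq, hunit k, one_pow])
          (by rw [hev]; exact hpos k) (by rw [hev]; linarith [hk₀ k hk])
        rw [hev, eval_tangentialNormSq_rayleighPoly hA, ← pow_mul] at h
        refine h.trans (pow_le_pow_left₀ (by positivity) ?_ _)
        rw [dist_comm, dist_eq_norm, mul_assoc]
        exact mul_le_mul_of_nonneg_left (htan k) (Nat.cast_nonneg m)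
  obtain ⟨z, hz⟩ := hconv
  refine ⟨z, isEigenvector_of_tangentialVec_eq_zero ?_ ?_, hz⟩
  · exact tendsto_nhds_unique hz.norm (by simp [hunit])
  · have h1 : Filter.Tendsto (fun k => B * ‖x (k + 1) - x k‖) Filter.atTop (nhds 0) := by
      have h2 := ((hz.comp (Filter.tendsto_add_atTop_nat 1)).sub hz).norm.const_mul B
      simpa using h2
    have h2 := squeeze_zero_norm htan h1
    exact tendsto_nhds_unique ((continuous_tangentialVec A).tendsto z |>.comp hz) h2

end Convergence

end SymTensor

end


theorem mainTheorem3 {m n : ℕ} (hm : 2 ≤ m) (hm_even : Even m)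
    (a : EuclideanSpace ℝ (Fin n)) (ha : ‖a‖ = 1)
    (E : SymTensor.Tensor m n) (hE : SymTensor.IsSymmetric E)
    (A : SymTensor.Tensor m n) (lam : ℝ) (hlam : 0 < lam)
    (hA : A = lam • SymTensor.rankOne m a + E)
    (α : ℝ) (hα : SymTensor.beta E < α)
    (x₀ : EuclideanSpace ℝ (Fin n)) (hx₀ : ‖x₀‖ = 1) :
    (∀ k, SymTensor.shiftedMap A α (SymTensor.ssHopm A α x₀ k) ≠ 0) ∧
    (∀ k, SymTensor.rayleigh A (SymTensor.ssHopm A α x₀ k) ≤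
      SymTensor.rayleigh A (SymTensor.ssHopm A α x₀ (k + 1))) ∧
    (∀ k, ¬ SymTensor.IsEigenvector A (SymTensor.ssHopm A α x₀ k) →
      SymTensor.rayleigh A (SymTensor.ssHopm A α x₀ k) <
        SymTensor.rayleigh A (SymTensor.ssHopm A α x₀ (k + 1))) ∧
    ∃ x : EuclideanSpace ℝ (Fin n), SymTensor.IsEigenvector A x ∧
      Filter.Tendsto (SymTensor.ssHopm A α x₀) Filter.atTop (nhds x) := by
  subst hA
  refine SymTensor.ssHopm_converges hm (SymTensor.isSymmetric_smul_rankOne_add lam a hE)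
    (SymTensor.beta_nonneg (by omega) E) hα (fun x hx v => ?_) hx₀
  -- The rank-one part only raises the form, so the constant `beta E` also serves for the whole
  -- tensor.
  rw [SymTensor.contractForm_smul_add, mul_add]
  have h1 := SymTensor.neg_beta_mul_le_contractForm hm hE ha hx v
  have h2 := mul_nonneg hlam.le (SymTensor.contractForm_rankOne_nonneg hm hm_even a x v)
  have hm2 : (2 : ℝ) ≤ m := by exact_mod_cast hm
  have h3 := mul_nonneg (by linarith : (0 : ℝ) ≤ (m : ℝ) - 1) h2
  linarith
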